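/- **Definitions.** An *oriented cubic ring* is a pair $(R,\delta)$, where $R$ is a commutative ring with unit that is free of rank $3$ as a $\mathbb Z$-module and $\delta:\wedge^3R\to\mathbb Z$ is an isomorphism; an isomorphism $(R,\delta)\to(R',\delta')$ is a ring isomorphism $\varphi$ with $\delta'\circ\wedge^3\varphi=\delta$. Its discriminant is $\mathrm{Disc}(R)=\det(\mathrm{Tr}(\alpha_i\alpha_j))$ for any $\mathbb Z$-basis $\alpha_1,\alpha_2,\alpha_3$. For a primitive integral binary quadratic form $Q$, we say that $(R,\delta)$ *has shape* $Q$ if $\mathrm{Disc}(R)\ne0$ and the trace-zero part of $\mathbb Z+3R$ has a $\mathbb Z$-basis $e_0,e_1$ with $\delta(1\wedge e_0\wedge e_1)>0$ such that $\mathrm{Tr}((xe_0+ye_1)^2)=n\,Q(x,y)$ for some positive integer $n$. We say that $(R,\delta)$ *corresponds* to the integral binary cubic form $f=ax^3+bx^2y+cxy^2+dy^3$ (Delone–Faddeev) if $R$ has a $\mathbb Z$-basis $1,\omega,\theta$ with $\delta(1\wedge\omega\wedge\theta)=1$ and $\omega^2=-ac+b\omega-a\theta$, $\omega\theta=-ad$,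 $\theta^2=-bd+d\omega-c\theta$. The Hessian of $f$ is $H_f=(b^2-3ac)x^2+(bc-9ad)xy+(c^2-3bd)y^2$. A cubic ring is a *$C_3$-cubic ring* if it has nonzero discriminant and a ring automorphism of order $3$. For $Q(x,y)=rx^2+sxy+ty^2$ with integer coefficients put $\mathrm{Disc}(Q)=s^2-4rt$, $Q'(x,y)=tx^2-sxy+ry^2$, $\mathrm{SO}_Q(\mathbb Z)=\{\gamma\in\mathrm{SL}_2(\mathbb Z):Q((x,y)\gamma)=Q(x,y)\}$, $$L(Q)=\{(b,c)^t\in\mathbb Z^2: sb\equiv rc \ (\mathrm{mod}\ 3t),\ sc\equiv tb\ (\mathrm{mod}\ 3r)\},\qquad L(Q)^+=\Big\{(b,c)^t\in L(Q):\frac{Q'(b,c)}{rt}>0\Big\}.$$ If $\mathrm{Disc}(Q)$ is not a square (so $rt\neq0$), then $\gamma\cdot v=\gamma^3v$ defines an action of $\mathrm{SO}_Q(\mathbb Z)$ on $L(Q)^+$, the *cubic action*. **Theorem.** (1) Let $Q(x,y)=rx^2+sxy+ty^2$ be a primitive integral binary quadratic form with non-square discriminant. There is a bijection between the set of orbits of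 the cubic action of $\mathrm{SO}_Q(\mathbb Z)$ on $L(Q)^+$ and the set of isomorphism classes of oriented cubic rings having shape $Q$, under which the orbit of $(b,c)^t$ is matched with the class of $R$ if and only if $R$ corresponds to a binary cubic form $ax^3+bx^2y+cxy^2+dy^3$, with these middle coefficients $b,c$, whose Hessian is a positive integer multiple of $Q$. Under this bijection $$\mathrm{Disc}(R)=-\frac{Q'(b,c)^2\,\mathrm{Disc}(Q)}{3r^2t^2}.$$ (2) Let $Q(x,y)=x^2+xy+y^2$. Then $L(Q)^+$ is the set of nonzero $(b,c)^t\in\mathbb Z^2$ with $b\equiv c\pmod 3$, and there is a bijection, characterized as in (1), between the orbits of the cubic action of $\mathrm{SO}_Q(\mathbb Z)$ on this set and the isomorphism classes of oriented $C_3$-cubic rings. Under this bijection $\mathrm{Disc}(R)=Q'(b,c)^2=(b^2-bc+c^2)^2$. -/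

import Mathlib

universe u

open Module

namespace CubicShape

noncomputable section

/-! ### Binary quadratic forms and the cubic action -/

/-- The integral binary quadratic form `r x² + s x y + t y²`. -/
structure BinaryQuadraticForm where
  r : ℤ
  s : ℤ
  t : ℤ

namespace BinaryQuadraticForm

variable (Q : BinaryQuadraticForm)

/-- The value `Q(x, y)`, with `v = (x, y)`. -/
def eval (v : Fin 2 → ℤ) : ℤ := Q.r * v 0 ^ 2 + Q.s * v 0 * v 1 + Q.t * v 1 ^ 2

/-- The discriminant `s² - 4 r t`. -/
def disc : ℤ := Q.s ^ 2 - 4 * Q.r * Q.t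

/-- The coefficients have no common divisor except `1` and `-1`. -/
def IsPrimitive : Prop := ∀ d : ℤ, d ∣ Q.r → d ∣ Q.s → d ∣ Q.t → IsUnit d

/-- The adjoint form `Q'(x, y) = t x² - s x y + r y²`. -/
def adjoint : BinaryQuadraticForm := ⟨Q.t, -Q.s, Q.r⟩

/-- The integral special orthogonal group `SO_Q(ℤ)`: all `γ ∈ SL₂(ℤ)` with
`Q((x, y) γ) = Q(x, y)`, where `(x, y)` is a row vector. -/
def SO : Subgroup (Matrix.SpecialLinearGroup (Fin 2) ℤ) where
  carrier := {γ | ∀ v : Fin 2 → ℤ, Q.eval (Matrix.vecMul v γ.1) = Q.eval v}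
  one_mem' := by
    intro v
    simp
  mul_mem' := by
    intro γ δ hγ hδ v
    have h := hδ (Matrix.vecMul v γ.1)
    rw [Matrix.vecMul_vecMul] at h
    exact h.trans (hγ v)
  inv_mem' := by
    intro γ hγ v
    have h := hγ (Matrix.vecMul v (γ⁻¹).1)
    rw [Matrix.vecMul_vecMul, ← Matrix.SpecialLinearGroup.coe_mul, inv_mul_cancel] at h
    simpa using h.symm

/-- The lattice `L(Q)` of all `(b, c) ∈ ℤ²` with `s b ≡ r c (mod 3t)` and
`s c ≡ t b (mod 3r)`. -/
def L : Set (Fin 2 → ℤ) :=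
  {v | Q.s * v 0 ≡ Q.r * v 1 [ZMOD 3 * Q.t] ∧ Q.s * v 1 ≡ Q.t * v 0 [ZMOD 3 * Q.r]}

/-- The subset `L(Q)⁺` of all `(b, c) ∈ L(Q)` with `Q'(b, c) / (r t) > 0`. -/
def LPlus : Set (Fin 2 → ℤ) :=
  {v | v ∈ Q.L ∧ 0 < (Q.adjoint.eval v : ℚ) / ((Q.r : ℚ) * (Q.t : ℚ))}

variable {Q}

theorem r_ne_zero (hQ : ¬ IsSquare Q.disc) : Q.r ≠ 0 := by
  intro h
  exact hQ ⟨Q.s, by simp [disc, h]; ring⟩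

theorem t_ne_zero (hQ : ¬ IsSquare Q.disc) : Q.t ≠ 0 := by
  intro h
  exact hQ ⟨Q.s, by simp [disc, h]; ring⟩

theorem SO_relations {γ : Matrix.SpecialLinearGroup (Fin 2) ℤ} (hγ : γ ∈ Q.SO) :
    Q.t * (γ.1 0 0 - γ.1 1 1) = Q.s * γ.1 1 0 ∧ Q.t * γ.1 0 1 = -(Q.r * γ.1 1 0) := by
  have e2 := hγ ![0, 1]
  have e3 := hγ ![1, 1]
  have e1 := hγ ![1, 0]
  have hd := γ.2
  rw [Matrix.det_fin_two] at hd
  simp [eval, Matrix.vecMul, dotProduct, Fin.sum_univ_two] at e1 e2 e3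
  constructor
  · have : 2 * (Q.t * (γ.1 0 0 - γ.1 1 1)) = 2 * (Q.s * γ.1 1 0) := by
      linear_combination γ.1 1 0 * (e3 - e1 - e2) - 2 * γ.1 0 0 * e2 +
        (γ.1 1 0 * Q.s + 2 * γ.1 1 1 * Q.t) * hd
    linarith
  · have : 2 * (Q.t * γ.1 0 1) = 2 * -(Q.r * γ.1 1 0) := by
      linear_combination γ.1 1 1 * (e3 - e1 - e2) - 2 * γ.1 0 1 * e2 -
        (2 * γ.1 1 0 * Q.r + γ.1 1 1 * Q.s) * hd
    linarith

theorem SO_comm (hQ : ¬ IsSquare Q.disc) (γ δ : Q.SO) : Commute γ δ := by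
  have ht := t_ne_zero hQ
  obtain ⟨g1, g2⟩ := SO_relations γ.2
  obtain ⟨d1, d2⟩ := SO_relations δ.2
  have key : ∀ x y : ℤ, Q.t * x = Q.t * y → x = y := fun x y h => mul_left_cancel₀ ht h
  apply Subtype.ext
  apply Matrix.SpecialLinearGroup.ext
  intro i j
  fin_cases i <;> fin_cases j <;>
    simp [Matrix.mul_apply, Fin.sum_univ_two] <;> apply key
  · linear_combination δ.1.1 1 0 * g2 - γ.1.1 1 0 * d2
  · apply key
    linear_combination (Q.t * (γ.1.1 0 0 - γ.1.1 1 1)) * d2 - (Q.t * (δ.1.1 0 0 - δ.1.1 1 1)) * g2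
      - Q.r * δ.1.1 1 0 * g1 + Q.r * γ.1.1 1 0 * d1
  · linear_combination γ.1.1 1 0 * d1 - δ.1.1 1 0 * g1
  · linear_combination γ.1.1 1 0 * d2 - δ.1.1 1 0 * g2

theorem cubic_covariance {r s t p q u w b c a d : ℤ} (hr : r ≠ 0) (ht : t ≠ 0)
    (g1 : t * (p - w) = s * u) (g2 : t * q = -(r * u))
    (ha : s * b - r * c = 3 * t * a) (hd : s * c - t * b = 3 * r * d) :
    s * (p * (p * (p * b + q * c) + q * (u * b + w * c)) +
        q * (u * (p * b + q * c) + w * (u * b + w * c))) -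
      r * (u * (p * (p * b + q * c) + q * (u * b + w * c)) +
        w * (u * (p * b + q * c) + w * (u * b + w * c))) =
      3 * t * (a * p ^ 3 + b * p ^ 2 * q + c * p * q ^ 2 + d * q ^ 3) ∧
    s * (u * (p * (p * b + q * c) + q * (u * b + w * c)) +
        w * (u * (p * b + q * c) + w * (u * b + w * c))) -
      t * (p * (p * (p * b + q * c) + q * (u * b + w * c)) +
        q * (u * (p * b + q * c) + w * (u * b + w * c))) =
      3 * r * (a * u ^ 3 + b * u ^ 2 * w + c * u * w ^ 2 + d * w ^ 3) := by
  have ht' : (t : ℚ) ≠ 0 := by exact_mod_cast ht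
  have hr' : (r : ℚ) ≠ 0 := by exact_mod_cast hr
  have g1' : (t : ℚ) * (p - w) = s * u := by exact_mod_cast g1
  have g2' : (t : ℚ) * q = -(r * u) := by exact_mod_cast g2
  have ha' : (s : ℚ) * b - r * c = 3 * t * a := by exact_mod_cast ha
  have hd' : (s : ℚ) * c - t * b = 3 * r * d := by exact_mod_cast hd
  obtain ⟨W, hW⟩ : ∃ W : ℚ, (u : ℚ) = t * W := ⟨u / t, by field_simp⟩
  have hp : (p : ℚ) = w + s * W := by
    apply mul_left_cancel₀ ht'
    linear_combination g1' + s * hW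
  have hq : (q : ℚ) = -(r * W) := by
    apply mul_left_cancel₀ ht'
    linear_combination g2' - r * hW
  have ha2 : (a : ℚ) = (s * b - r * c) / (3 * t) := by
    field_simp
    linear_combination -ha'
  have hd2 : (d : ℚ) = (s * c - t * b) / (3 * r) := by
    field_simp
    linear_combination -hd'
  constructor
  · have : ((s * (p * (p * (p * b + q * c) + q * (u * b + w * c)) +
        q * (u * (p * b + q * c) + w * (u * b + w * c))) -
      r * (u * (p * (p * b + q * c) + q * (u * b + w * c)) +
        w * (u * (p * b + q * c) + w * (u * b + w * c))) : ℤ) : ℚ) =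
      ((3 * t * (a * p ^ 3 + b * p ^ 2 * q + c * p * q ^ 2 + d * q ^ 3) : ℤ) : ℚ) := by
      push_cast
      rw [ha2, hd2, hp, hq, hW]
      field_simp
      ring
    exact_mod_cast this
  · have : ((s * (u * (p * (p * b + q * c) + q * (u * b + w * c)) +
        w * (u * (p * b + q * c) + w * (u * b + w * c))) -
      t * (p * (p * (p * b + q * c) + q * (u * b + w * c)) +
        q * (u * (p * b + q * c) + w * (u * b + w * c))) : ℤ) : ℚ) =
      ((3 * r * (a * u ^ 3 + b * u ^ 2 * w + c * u * w ^ 2 + d * w ^ 3) : ℤ) : ℚ) := by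
      push_cast
      rw [ha2, hd2, hp, hq, hW]
      field_simp
      ring
    exact_mod_cast this

/-- The cubic action of `SO_Q(ℤ)` preserves `L(Q)⁺`. -/
theorem cube_mulVec_mem (hQ : ¬ IsSquare Q.disc) (γ : Q.SO) {v : Fin 2 → ℤ} (hv : v ∈ Q.LPlus) :
    Matrix.mulVec (γ ^ 3).1.1 v ∈ Q.LPlus := by
  have ht := t_ne_zero hQ
  have hr := r_ne_zero hQ
  obtain ⟨g1, g2⟩ := SO_relations γ.2
  obtain ⟨⟨h1, h2⟩, h3⟩ := hv
  obtain ⟨a, ha⟩ := h1.symm.dvd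
  obtain ⟨d, hd⟩ := h2.symm.dvd
  have hdet := γ.1.2
  rw [Matrix.det_fin_two] at hdet
  have e : Matrix.mulVec (γ ^ 3).1.1 v =
      Matrix.mulVec γ.1.1 (Matrix.mulVec γ.1.1 (Matrix.mulVec γ.1.1 v)) := by
    rw [Matrix.mulVec_mulVec, Matrix.mulVec_mulVec]
    congr 1
    simp [pow_succ, Matrix.mul_assoc]
  have hinv : ∀ w : Fin 2 → ℤ,
      Q.adjoint.eval (Matrix.mulVec γ.1.1 w) = Q.adjoint.eval w := by
    intro w
    apply mul_left_cancel₀ ht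
    simp only [eval, adjoint, Matrix.mulVec, dotProduct, Fin.sum_univ_two]
    generalize γ.1.1 0 0 = p at *
    generalize γ.1.1 0 1 = q at *
    generalize γ.1.1 1 0 = u at *
    generalize γ.1.1 1 1 = z at *
    grind
  obtain ⟨c1, c2⟩ := cubic_covariance hr ht g1 g2 ha hd
  rw [e]
  refine ⟨⟨?_, ?_⟩, by rw [hinv, hinv, hinv]; exact h3⟩
  · refine ((Int.modEq_iff_dvd).2 ?_).symm
    simp only [Matrix.mulVec, dotProduct, Fin.sum_univ_two]
    exact ⟨_, c1⟩
  · refine ((Int.modEq_iff_dvd).2 ?_).symm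
    simp only [Matrix.mulVec, dotProduct, Fin.sum_univ_two]
    exact ⟨_, c2⟩

/-- The cubic action `γ · v = γ³ v` of `SO_Q(ℤ)` on `L(Q)⁺`. -/
abbrev cubicAction (Q : BinaryQuadraticForm) (hQ : ¬ IsSquare Q.disc) :
    MulAction Q.SO Q.LPlus where
  smul γ v := ⟨Matrix.mulVec (γ ^ 3).1.1 v.1, cube_mulVec_mem hQ γ v.2⟩
  one_smul v := by
    apply Subtype.ext
    change Matrix.mulVec ((1 : Q.SO) ^ 3).1.1 v.1 = v.1
    simp
  mul_smul γ δ v := by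
    apply Subtype.ext
    change Matrix.mulVec ((γ * δ) ^ 3).1.1 v.1 =
      Matrix.mulVec (γ ^ 3).1.1 (Matrix.mulVec (δ ^ 3).1.1 v.1)
    rw [Matrix.mulVec_mulVec, (SO_comm hQ γ δ).mul_pow]
    rfl

/-- The set of orbits of the cubic action of `SO_Q(ℤ)` on `L(Q)⁺`. -/
def CubicOrbits (Q : BinaryQuadraticForm) (hQ : ¬ IsSquare Q.disc) : Type :=
  letI := cubicAction Q hQ
  MulAction.orbitRel.Quotient Q.SO Q.LPlus

/-- The orbit of `v ∈ L(Q)⁺`. -/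
def cubicOrbit (Q : BinaryQuadraticForm) (hQ : ¬ IsSquare Q.disc) (v : Q.LPlus) :
    CubicOrbits Q hQ :=
  letI := cubicAction Q hQ
  Quotient.mk (MulAction.orbitRel Q.SO Q.LPlus) v

/-- The form `x² + x y + y²`. -/
def eisenstein : BinaryQuadraticForm := ⟨1, 1, 1⟩

theorem eisenstein_disc : ¬ IsSquare eisenstein.disc := by
  rintro ⟨n, hn⟩
  have : eisenstein.disc = -3 := by simp [eisenstein, disc]
  nlinarith [mul_self_nonneg n]

end BinaryQuadraticForm

/-! ### Binary cubic forms -/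

/-- The integral binary cubic form `a x³ + b x² y + c x y² + d y³`. -/
structure BinaryCubicForm where
  a : ℤ
  b : ℤ
  c : ℤ
  d : ℤ

/-- The Hessian of `f`, namely `-1/4` times the determinant of the matrix of second partial
derivatives: `(b² - 3 a c) x² + (b c - 9 a d) x y + (c² - 3 b d) y²`. -/
def BinaryCubicForm.hessian (f : BinaryCubicForm) : BinaryQuadraticForm :=
  ⟨f.b ^ 2 - 3 * f.a * f.c, f.b * f.c - 9 * f.a * f.d, f.c ^ 2 - 3 * f.b * f.d⟩

/-! ### Oriented cubic rings -/

/-- An oriented cubic ring `(R, δ)`: a commutative ring `R`, free of rank `3` as a `ℤ`-module,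
with an isomorphism `δ : ⋀³ R ≃ ℤ`. -/
structure OrientedCubicRing where
  carrier : Type u
  [commRing : CommRing carrier]
  [free : Module.Free ℤ carrier]
  finrank_eq : Module.finrank ℤ carrier = 3
  orientation : (⋀[ℤ]^3 carrier) ≃ₗ[ℤ] ℤ

attribute [instance] OrientedCubicRing.commRing OrientedCubicRing.free

namespace OrientedCubicRing

/-- The integer `δ(x ∧ y ∧ z)`. -/
def vol (R : OrientedCubicRing.{u}) (x y z : R.carrier) : ℤ :=
  R.orientation (exteriorPower.ιMulti ℤ 3 ![x, y, z])

/-- `φ` is an isomorphism of oriented cubic rings if `δ_S ∘ ⋀³ φ = δ_R`. -/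
def IsOrientedIso (R S : OrientedCubicRing.{u}) (φ : R.carrier ≃+* S.carrier) : Prop :=
  ∀ ω : ⋀[ℤ]^3 R.carrier,
    S.orientation (exteriorPower.map 3 φ.toAddEquiv.toIntLinearEquiv.toLinearMap ω) =
      R.orientation ω

/-- Isomorphism of oriented cubic rings, as an equivalence relation. -/
def isoSetoid : Setoid OrientedCubicRing.{u} where
  r R S := ∃ φ : R.carrier ≃+* S.carrier, IsOrientedIso R S φ
  iseqv := by
    refine ⟨fun R => ⟨RingEquiv.refl _, fun ω => ?_⟩, ?_, ?_⟩
    · have : (RingEquiv.refl R.carrier).toAddEquiv.toIntLinearEquiv.toLinearMap =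
          LinearMap.id := rfl
      rw [this, exteriorPower.map_id]
      rfl
    · rintro R S ⟨φ, hφ⟩
      refine ⟨φ.symm, fun ω => ?_⟩
      rw [← hφ, ← LinearMap.comp_apply, ← exteriorPower.map_comp]
      have : φ.toAddEquiv.toIntLinearEquiv.toLinearMap ∘ₗ
          φ.symm.toAddEquiv.toIntLinearEquiv.toLinearMap = LinearMap.id := by
        ext x
        simp
      rw [this, exteriorPower.map_id]
      rfl
    · rintro R S T ⟨φ, hφ⟩ ⟨ψ, hψ⟩
      refine ⟨φ.trans ψ, fun ω => ?_⟩
      rw [← hφ, ← hψ, ← LinearMap.comp_apply, ← exteriorPower.map_comp]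
      rfl

variable (R : OrientedCubicRing.{u})

/-- A `ℤ`-basis of `R`. -/
def basis : Basis (Fin 3) ℤ R.carrier :=
  haveI : Module.Finite ℤ R.carrier :=
    Module.finite_of_finrank_pos (by rw [R.finrank_eq]; norm_num)
  Module.finBasisOfFinrankEq ℤ R.carrier R.finrank_eq

/-- The discriminant `det (Tr (αᵢ αⱼ))` for a `ℤ`-basis `α₁, α₂, α₃` of `R`. -/
def disc : ℤ := Algebra.discr ℤ R.basis

/-- The discriminant does not depend on the basis. -/
theorem disc_eq (b : Basis (Fin 3) ℤ R.carrier) : R.disc = Algebra.discr ℤ b :=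
  Algebra.discr_eq_discr R.carrier R.basis b

/-- The trace-zero part of `ℤ + 3R`. -/
def traceZero : Submodule ℤ R.carrier :=
  (Submodule.span ℤ {1} ⊔ LinearMap.range ((3 : ℤ) • (LinearMap.id : R.carrier →ₗ[ℤ] R.carrier))) ⊓
    LinearMap.ker (Algebra.trace ℤ R.carrier)

/-- `R` has shape (the `SL₂(ℤ)`-class of) the primitive form `Q`: the discriminant of `R` is
nonzero, and in some oriented basis `e₀, e₁` of the trace-zero part of `ℤ + 3R` the trace form
`Tr(z²)` is `n Q` with a positive integer `n`. A basis is oriented if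
`δ(1 ∧ e₀ ∧ e₁) > 0`. -/
def HasShape (Q : BinaryQuadraticForm) : Prop :=
  R.disc ≠ 0 ∧ Q.IsPrimitive ∧
    ∃ (e : Basis (Fin 2) ℤ R.traceZero) (n : ℤ), 0 < n ∧ 0 < R.vol 1 (e 0) (e 1) ∧
      ∀ v : Fin 2 → ℤ,
        Algebra.trace ℤ R.carrier ((v 0 • (e 0 : R.carrier) + v 1 • (e 1 : R.carrier)) ^ 2) =
          n * Q.eval v

/-- `R` corresponds to the binary cubic form `f` under the Delone-Faddeev correspondence: `R` has
a `ℤ`-basis `1, ω, θ` with `δ(1 ∧ ω ∧ θ) = 1` and the multiplication table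
`ω² = -ac + b ω - a θ`, `ω θ = -ad`, `θ² = -bd + d ω - c θ`. -/
def CorrespondsTo (f : BinaryCubicForm) : Prop :=
  ∃ e : Basis (Fin 3) ℤ R.carrier, e 0 = 1 ∧ R.vol 1 (e 1) (e 2) = 1 ∧
    e 1 * e 1 = (-(f.a * f.c)) • (1 : R.carrier) + f.b • e 1 - f.a • e 2 ∧
    e 1 * e 2 = (-(f.a * f.d)) • (1 : R.carrier) ∧
    e 2 * e 2 = (-(f.b * f.d)) • (1 : R.carrier) + f.d • e 1 - f.c • e 2

/-- `R` is a `C₃`-cubic ring: it has nonzero discriminant and a ring automorphism of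
order `3`. -/
def IsC3 : Prop := R.disc ≠ 0 ∧ ∃ σ : R.carrier ≃+* R.carrier, orderOf σ = 3

/-- Isomorphism classes of the oriented cubic rings with a property `P`. -/
def Classes (P : OrientedCubicRing.{u} → Prop) : Type (u + 1) :=
  Quotient (isoSetoid.{u}.comap (Subtype.val : {R // P R} → OrientedCubicRing.{u}))

/-- The isomorphism class of an oriented cubic ring with the property `P`. -/
def cls {P : OrientedCubicRing.{u} → Prop} (R : {R : OrientedCubicRing.{u} // P R}) : Classes P :=
  Quotient.mk _ R

end OrientedCubicRing

/-- The oriented cubic ring `R` comes from `v = (b, c)` relative to `Q`: it corresponds to a binary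
cubic form `a x³ + b x² y + c x y² + d y³` whose Hessian is a positive integer multiple of `Q`. -/
def ComesFrom (Q : BinaryQuadraticForm) (v : Fin 2 → ℤ) (R : OrientedCubicRing.{u}) : Prop :=
  ∃ f : BinaryCubicForm, f.b = v 0 ∧ f.c = v 1 ∧
    (∃ n : ℤ, 0 < n ∧ f.hessian = ⟨n * Q.r, n * Q.s, n * Q.t⟩) ∧ R.CorrespondsTo f

end

end CubicShape

open CubicShape

/-! The bridge is the binary cubic form. Bases `1, ω, θ` with `ωθ ∈ ℤ` identify isomorphism classes
of oriented cubic rings with `SL₂(ℤ)`-classes of cubic forms (`exists_correspondsTo`,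
`CorrespondsTo.exists_act`, `CorrespondsTo.iso`, `exists_ring_correspondsTo`). On the basis `3ω - b,
3θ + c` of the trace-zero part of `ℤ + 3R`, the form `Tr(z²)` is six times the Hessian
(`IsNormalBasis.trace_sq`). So `R` has shape `Q` exactly when one of its forms has Hessian `nQ` with
`n > 0`.

If the Hessian of `f` is `nQ`, syzygies between `f` and its Hessian give `sb - rc = 3ta` and `sc -
tb = 3rd` (`outer_of_hessian`). Thus `b, c` determine `f`, integrality of `a, d` is membership in
`L(Q)`, and `Q'(b,c) = nrt` turns `n > 0` into the sign condition. Primitivity of `Q` makes `n` an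
integer in the converse direction.

Two such forms of one ring differ by some `γ ∈ SL₂(ℤ)`; the discriminant fixes `n`, so `γ ∈
SO_Q(ℤ)`. Over `ℚ(√Disc Q)` the form `Q` is a multiple of `ℓℓ̄`, and `f = λℓ³ + λ̄ℓ̄³`. As `γ`
scales `ℓ` by some `ε` of norm one, it scales `λ` by `ε³`: hence the cubic action.
`middle_covariance` checks this as an identity in the coefficients.

For part (2), an automorphism of order three acts on `R/ℤ` by a matrix `M` with `M² + M + 1 = 0`
that preserves the Hessian, which is then equivalent to a multiple of `x² + xy + y²`. Conversely, a
form with such a Hessian is fixed by an element of order three of `SL₂(ℤ)`. -/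

namespace CubicShape

/-! ### Binary cubic forms under `SL₂(ℤ)` -/

namespace BinaryCubicForm

/-- The value `f(x, y)`. -/
def eval (f : BinaryCubicForm) (x y : ℤ) : ℤ :=
  f.a * x ^ 3 + f.b * x ^ 2 * y + f.c * x * y ^ 2 + f.d * y ^ 3

/-- The discriminant of a binary cubic form. -/
def disc (f : BinaryCubicForm) : ℤ :=
  f.b ^ 2 * f.c ^ 2 - 4 * f.a * f.c ^ 3 - 4 * f.b ^ 3 * f.d - 27 * f.a ^ 2 * f.d ^ 2 +
    18 * f.a * f.b * f.c * f.d

/-- The form `f((x, y) γ)`. -/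
def act (f : BinaryCubicForm) (γ : Matrix.SpecialLinearGroup (Fin 2) ℤ) : BinaryCubicForm where
  a := f.eval (γ.1 0 0) (γ.1 0 1)
  b := 3 * f.a * γ.1 0 0 ^ 2 * γ.1 1 0 +
    f.b * (γ.1 0 0 ^ 2 * γ.1 1 1 + 2 * γ.1 0 0 * γ.1 0 1 * γ.1 1 0) +
    f.c * (γ.1 0 1 ^ 2 * γ.1 1 0 + 2 * γ.1 0 0 * γ.1 0 1 * γ.1 1 1) +
    3 * f.d * γ.1 0 1 ^ 2 * γ.1 1 1
  c := 3 * f.a * γ.1 0 0 * γ.1 1 0 ^ 2 +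
    f.b * (γ.1 1 0 ^ 2 * γ.1 0 1 + 2 * γ.1 0 0 * γ.1 1 0 * γ.1 1 1) +
    f.c * (γ.1 1 1 ^ 2 * γ.1 0 0 + 2 * γ.1 0 1 * γ.1 1 0 * γ.1 1 1) +
    3 * f.d * γ.1 0 1 * γ.1 1 1 ^ 2
  d := f.eval (γ.1 1 0) (γ.1 1 1)

theorem eval_act (f : BinaryCubicForm) (γ : Matrix.SpecialLinearGroup (Fin 2) ℤ) (x y : ℤ) :
    (f.act γ).eval x y =
      f.eval (x * γ.1 0 0 + y * γ.1 1 0) (x * γ.1 0 1 + y * γ.1 1 1) := by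
  simp only [act, eval]
  ring

theorem eq_of_eval {f g : BinaryCubicForm} (h : ∀ x y, f.eval x y = g.eval x y) : f = g := by
  obtain ⟨a, b, c, d⟩ := f
  obtain ⟨a', b', c', d'⟩ := g
  have h1 := h 1 0
  have h2 := h 0 1
  have h3 := h 1 1
  have h4 := h 1 (-1)
  simp [eval] at h1 h2 h3 h4
  simp only [mk.injEq]
  omega

theorem hessian_act (f : BinaryCubicForm) (γ : Matrix.SpecialLinearGroup (Fin 2) ℤ)
    (v : Fin 2 → ℤ) :
    (f.act γ).hessian.eval v = f.hessian.eval (Matrix.vecMul v γ.1) := by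
  have hd := γ.2
  rw [Matrix.det_fin_two] at hd
  simp only [act, eval, hessian, BinaryQuadraticForm.eval, Matrix.vecMul, dotProduct,
    Fin.sum_univ_two]
  generalize γ.1 0 0 = p at *
  generalize γ.1 0 1 = q at *
  generalize γ.1 1 0 = u at *
  generalize γ.1 1 1 = w at *
  obtain ⟨a, b, c, d⟩ := f
  -- The Hessian is a covariant of weight two: the identity with the factor `det² ` holds for every
  -- matrix, so `ring` can prove it.
  have key : ∀ X Y D E : ℤ, D = 1 → X = D ^ 2 * Y → X = Y := by
    rintro X Y D E rfl h; linarith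
  refine key _ _ _ 0 hd ?_
  ring

theorem three_mul_disc (f : BinaryCubicForm) : 3 * f.disc = -f.hessian.disc := by
  simp only [disc, hessian, BinaryQuadraticForm.disc]
  ring

end BinaryCubicForm

/-! ### Cubic forms whose Hessian is a multiple of `Q` -/

namespace BinaryQuadraticForm

variable {Q : BinaryQuadraticForm}

theorem eq_of_eval {P Q : BinaryQuadraticForm} (h : ∀ v, P.eval v = Q.eval v) : P = Q := by
  obtain ⟨r, s, t⟩ := P
  obtain ⟨r', s', t'⟩ := Q
  have h1 := h ![1, 0]
  have h2 := h ![0, 1]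
  have h3 := h ![1, 1]
  simp [eval] at h1 h2 h3
  simp only [mk.injEq]
  omega

/-- The form `n Q`. -/
def scale (n : ℤ) (Q : BinaryQuadraticForm) : BinaryQuadraticForm := ⟨n * Q.r, n * Q.s, n * Q.t⟩

theorem eval_scale (n : ℤ) (v : Fin 2 → ℤ) : (scale n Q).eval v = n * Q.eval v := by
  simp only [eval, scale]
  ring

theorem disc_scale (n : ℤ) : (scale n Q).disc = n ^ 2 * Q.disc := by
  simp only [disc, scale]
  ring

theorem disc_ne_zero (hQ : ¬ IsSquare Q.disc) : Q.disc ≠ 0 := by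
  intro h
  exact hQ (h ▸ ⟨0, by simp⟩)

/-- Divisibility of all coefficients of `n Q` passes to `n` if `Q` is primitive. -/
theorem IsPrimitive.dvd (hP : Q.IsPrimitive) {d n : ℤ} (hr : d ∣ n * Q.r) (hs : d ∣ n * Q.s)
    (ht : d ∣ n * Q.t) : d ∣ n := by
  by_cases h0 : Int.gcd d n = 0
  · rw [Int.gcd_eq_zero_iff] at h0
    simp [h0.2]
  obtain ⟨g, d', n', hg, hc, hd, hn⟩ := Int.exists_gcd_one' (Nat.pos_of_ne_zero h0)
  have hg' : (g : ℤ) ≠ 0 := by exact_mod_cast hg.ne'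
  -- With the gcd `g` removed, `d'` is coprime to `n'`; it divides every coefficient of `Q`, so it
  -- is a unit and `d` is associated to `g`.
  have key : ∀ x, d ∣ n * x → d' ∣ x := by
    intro x hx
    rw [hd, hn, mul_right_comm] at hx
    exact (Int.isCoprime_iff_gcd_eq_one.2 hc).dvd_of_dvd_mul_left ((mul_dvd_mul_iff_right hg').1 hx)
  have hu := hP d' (key _ hr) (key _ hs) (key _ ht)
  rw [hd, hn]
  exact mul_dvd_mul_right (hu.dvd) _

/-- The middle coefficients of `f` determine the outer ones if the Hessian is a nonzero multiple
of `Q`. -/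
theorem outer_of_hessian {f : BinaryCubicForm} {n : ℤ} (hn : n ≠ 0)
    (h : f.hessian = scale n Q) :
    Q.s * f.b - Q.r * f.c = 3 * Q.t * f.a ∧ Q.s * f.c - Q.t * f.b = 3 * Q.r * f.d := by
  simp only [BinaryCubicForm.hessian, scale, mk.injEq] at h
  obtain ⟨h1, h2, h3⟩ := h
  constructor
  -- For a Hessian `(A, B, C)` one has `bB - cA = 3aC` and `cB - bC = 3dA` identically.
  · apply mul_left_cancel₀ hn
    linear_combination -f.b * h2 + f.c * h1 + 3 * f.a * h3
  · apply mul_left_cancel₀ hn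
    linear_combination -f.c * h2 + f.b * h3 + 3 * f.d * h1

/-- By the first outer relation, `Q'(b,c) = tb² - c(sb - rc) = t(b² - 3ac)`, and the bracket is
`nr`. -/
theorem adjoint_eval_of_hessian {f : BinaryCubicForm} {n : ℤ} (hn : n ≠ 0)
    (h : f.hessian = scale n Q) :
    Q.adjoint.eval ![f.b, f.c] = n * (Q.r * Q.t) := by
  have h1 := (outer_of_hessian hn h).1
  simp only [BinaryCubicForm.hessian, scale, mk.injEq] at h
  simp [eval, adjoint]
  linear_combination Q.t * h.1 - f.c * h1

theorem mem_LPlus_of_hessian (hQ : ¬ IsSquare Q.disc) {f : BinaryCubicForm} {n : ℤ} (hn : 0 < n)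
    (h : f.hessian = scale n Q) : ![f.b, f.c] ∈ Q.LPlus := by
  obtain ⟨h1, h2⟩ := outer_of_hessian hn.ne' h
  have hr : (Q.r : ℚ) ≠ 0 := by exact_mod_cast r_ne_zero hQ
  have ht : (Q.t : ℚ) ≠ 0 := by exact_mod_cast t_ne_zero hQ
  refine ⟨⟨?_, ?_⟩, ?_⟩
  · refine (Int.modEq_iff_dvd.2 ⟨f.a, ?_⟩).symm
    simpa using h1
  · refine (Int.modEq_iff_dvd.2 ⟨f.d, ?_⟩).symm
    simpa using h2
  · rw [adjoint_eval_of_hessian hn.ne' h]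
    push_cast
    rw [mul_div_assoc, div_self (mul_ne_zero hr ht), mul_one]
    exact_mod_cast hn

/-- The outer coefficients are the quotients in the two congruences. With `N = Q'(b,c)`, the numbers
`Nr, Ns, Nt` are `rt` times the Hessian coefficients; primitivity yields `rt ∣ N`, and `n = N/(rt)`.
-/
theorem exists_form_of_mem_LPlus (hP : Q.IsPrimitive) (hQ : ¬ IsSquare Q.disc) {v : Fin 2 → ℤ}
    (hv : v ∈ Q.LPlus) :
    ∃ (f : BinaryCubicForm) (n : ℤ), f.b = v 0 ∧ f.c = v 1 ∧ 0 < n ∧ f.hessian = scale n Q := by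
  obtain ⟨⟨h1, h2⟩, h3⟩ := hv
  obtain ⟨a, ha⟩ := h1.symm.dvd
  obtain ⟨d, hd⟩ := h2.symm.dvd
  have hr := r_ne_zero hQ
  have ht := t_ne_zero hQ
  set N := Q.adjoint.eval v with hN
  have e0 : Q.t * (v 0 ^ 2 - 3 * a * v 1) = N := by
    simp only [hN, eval, adjoint]
    linear_combination v 1 * ha
  have e2 : Q.r * (v 1 ^ 2 - 3 * v 0 * d) = N := by
    simp only [hN, eval, adjoint]
    linear_combination v 0 * hd
  have e1 : Q.r * Q.t * (v 0 * v 1 - 9 * a * d) = N * Q.s := by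
    simp only [hN, eval, adjoint]
    linear_combination 3 * Q.r * d * ha + (Q.s * v 0 - Q.r * v 1) * hd
  obtain ⟨n, hn⟩ : Q.r * Q.t ∣ N :=
    hP.dvd ⟨v 0 ^ 2 - 3 * a * v 1, by linear_combination -Q.r * e0⟩ ⟨_, e1.symm⟩
      ⟨v 1 ^ 2 - 3 * v 0 * d, by linear_combination -Q.t * e2⟩
  refine ⟨⟨a, v 0, v 1, d⟩, n, rfl, rfl, ?_, ?_⟩
  · rw [hn] at h3
    have hr' : (Q.r : ℚ) ≠ 0 := by exact_mod_cast hr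
    have ht' : (Q.t : ℚ) ≠ 0 := by exact_mod_cast ht
    push_cast at h3
    rw [mul_div_cancel_left₀ _ (mul_ne_zero hr' ht')] at h3
    exact_mod_cast h3
  · simp only [BinaryCubicForm.hessian, scale, mk.injEq]
    refine ⟨mul_left_cancel₀ ht ?_, mul_left_cancel₀ (mul_ne_zero hr ht) ?_,
      mul_left_cancel₀ hr ?_⟩
    · linear_combination e0 + hn
    · linear_combination e1 + Q.s * hn
    · linear_combination e2 + hn

theorem middle_covariance {r s t p q u w b c a d : ℤ} (hr : r ≠ 0) (ht : t ≠ 0)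
    (g1 : t * (p - w) = s * u) (g2 : t * q = -(r * u))
    (ha : s * b - r * c = 3 * t * a) (hd : s * c - t * b = 3 * r * d) :
    3 * a * p ^ 2 * u + b * (p ^ 2 * w + 2 * p * q * u) + c * (q ^ 2 * u + 2 * p * q * w) +
        3 * d * q ^ 2 * w =
      p * (p * (p * b + q * c) + q * (u * b + w * c)) +
        q * (u * (p * b + q * c) + w * (u * b + w * c)) ∧
    3 * a * p * u ^ 2 + b * (u ^ 2 * q + 2 * p * u * w) + c * (w ^ 2 * p + 2 * q * u * w) +
        3 * d * q * w ^ 2 =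
      u * (p * (p * b + q * c) + q * (u * b + w * c)) +
        w * (u * (p * b + q * c) + w * (u * b + w * c)) := by
  have ht' : (t : ℚ) ≠ 0 := by exact_mod_cast ht
  have hr' : (r : ℚ) ≠ 0 := by exact_mod_cast hr
  have g1' : (t : ℚ) * (p - w) = s * u := by exact_mod_cast g1
  have g2' : (t : ℚ) * q = -(r * u) := by exact_mod_cast g2
  have ha' : (s : ℚ) * b - r * c = 3 * t * a := by exact_mod_cast ha
  have hd' : (s : ℚ) * c - t * b = 3 * r * d := by exact_mod_cast hd
  -- The relations of `SO_Q` leave two rational parameters: `p = w + sW`, `q = -rW`, `u = tW`. With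
  -- `a, d` eliminated too, a rational identity remains.
  obtain ⟨W, hW⟩ : ∃ W : ℚ, (u : ℚ) = t * W := ⟨u / t, by field_simp⟩
  have hp : (p : ℚ) = w + s * W := by
    apply mul_left_cancel₀ ht'
    linear_combination g1' + s * hW
  have hq : (q : ℚ) = -(r * W) := by
    apply mul_left_cancel₀ ht'
    linear_combination g2' - r * hW
  have ha2 : (a : ℚ) = (s * b - r * c) / (3 * t) := by
    field_simp
    linear_combination -ha'
  have hd2 : (d : ℚ) = (s * c - t * b) / (3 * r) := by
    field_simp
    linear_combination -hd'
  constructor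
  · rw [← Int.cast_inj (α := ℚ)]
    push_cast
    rw [ha2, hd2, hp, hq, hW]
    field_simp
    ring
  · rw [← Int.cast_inj (α := ℚ)]
    push_cast
    rw [ha2, hd2, hp, hq, hW]
    field_simp
    ring

/-- On middle coefficients, substitution by `γ ∈ SO_Q(ℤ)` is multiplication by `γ³`. -/
theorem middle_act (hQ : ¬ IsSquare Q.disc) {f : BinaryCubicForm} {n : ℤ} (hn : n ≠ 0)
    (h : f.hessian = scale n Q) (γ : Q.SO) {v : Fin 2 → ℤ} (h0 : f.b = v 0) (h1 : f.c = v 1) :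
    (f.act γ.1).b = Matrix.mulVec (γ ^ 3).1.1 v 0 ∧
      (f.act γ.1).c = Matrix.mulVec (γ ^ 3).1.1 v 1 := by
  obtain ⟨g1, g2⟩ := SO_relations γ.2
  obtain ⟨ha, hd⟩ := outer_of_hessian hn h
  have e : Matrix.mulVec (γ ^ 3).1.1 v =
      Matrix.mulVec γ.1.1 (Matrix.mulVec γ.1.1 (Matrix.mulVec γ.1.1 v)) := by
    rw [Matrix.mulVec_mulVec, Matrix.mulVec_mulVec]
    congr 1
    simp [pow_succ, Matrix.mul_assoc]
  rw [e]
  simp only [Matrix.mulVec, dotProduct, Fin.sum_univ_two, ← h0, ← h1]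
  exact middle_covariance (r_ne_zero hQ) (t_ne_zero hQ) g1 g2 ha hd

theorem hessian_act_of_mem_SO {f : BinaryCubicForm} {n : ℤ} (h : f.hessian = scale n Q)
    (γ : Q.SO) : (f.act γ.1).hessian = scale n Q := by
  apply eq_of_eval
  intro v
  rw [f.hessian_act, h, eval_scale, eval_scale, γ.2 v]

theorem mem_SO_of_hessian_act {f : BinaryCubicForm} {n : ℤ} (hn : n ≠ 0)
    {γ : Matrix.SpecialLinearGroup (Fin 2) ℤ} (h : f.hessian = scale n Q)
    (h' : (f.act γ).hessian = scale n Q) : γ ∈ Q.SO := by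
  intro v
  apply mul_left_cancel₀ hn
  rw [← eval_scale, ← eval_scale, ← h, ← f.hessian_act, h', h]

end BinaryQuadraticForm
end CubicShape

/-! ### Volumes, coordinates and the Delone–Faddeev correspondence -/

namespace CubicShape
namespace OrientedCubicRing

variable (R : OrientedCubicRing.{u})

/-- The alternating form `(x, y, z) ↦ δ(x ∧ y ∧ z)`. -/
noncomputable def volume : R.carrier [⋀^Fin 3]→ₗ[ℤ] ℤ :=
  R.orientation.toLinearMap.compAlternatingMap (exteriorPower.ιMulti ℤ 3)

theorem volume_apply (x y z : R.carrier) : R.volume ![x, y, z] = R.vol x y z := rfl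

variable {R}

/-- An alternating 3-form in rank three is determined by its value on one basis. -/
theorem isOrientedIso_iff {S : OrientedCubicRing.{u}} (φ : R.carrier ≃+* S.carrier)
    (e : Basis (Fin 3) ℤ R.carrier) :
    IsOrientedIso R S φ ↔ S.vol (φ (e 0)) (φ (e 1)) (φ (e 2)) = R.vol (e 0) (e 1) (e 2) := by
  have hmap : ∀ x y z, S.orientation (exteriorPower.map 3
      φ.toAddEquiv.toIntLinearEquiv.toLinearMap (exteriorPower.ιMulti ℤ 3 ![x, y, z])) =
      S.vol (φ x) (φ y) (φ z) := by
    intro x y z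
    rw [exteriorPower.map_apply_ιMulti, vol]
    congr 2
  constructor
  · intro h
    rw [← hmap]
    exact h _
  · intro h ω
    have he : (e : Fin 3 → R.carrier) = ![e 0, e 1, e 2] := by
      funext i
      fin_cases i <;> rfl
    have : S.orientation.toLinearMap ∘ₗ
        exteriorPower.map 3 φ.toAddEquiv.toIntLinearEquiv.toLinearMap =
        R.orientation.toLinearMap := by
      apply exteriorPower.linearMap_ext
      rw [AlternatingMap.eq_smul_basis_det e (LinearMap.compAlternatingMap
        (S.orientation.toLinearMap ∘ₗ _) _), AlternatingMap.eq_smul_basis_det e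
        (LinearMap.compAlternatingMap R.orientation.toLinearMap _)]
      congr 1
      rw [he]
      exact (hmap _ _ _).trans h
    exact LinearMap.congr_fun this ω

theorem vol_eq_mul_det (e : Basis (Fin 3) ℤ R.carrier) (x y z : R.carrier) :
    R.vol x y z = R.vol (e 0) (e 1) (e 2) * e.det ![x, y, z] := by
  have he : (e : Fin 3 → R.carrier) = ![e 0, e 1, e 2] := by
    funext i
    fin_cases i <;> rfl
  have h : R.volume e = R.vol (e 0) (e 1) (e 2) := congrArg R.volume he
  rw [← volume_apply, R.volume.eq_smul_basis_det e, AlternatingMap.smul_apply, h, smul_eq_mul]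

/-- Every value of `δ` is a multiple of the volume of a basis, and `δ` attains `1`. -/
theorem isUnit_vol (e : Basis (Fin 3) ℤ R.carrier) : IsUnit (R.vol (e 0) (e 1) (e 2)) := by
  rw [isUnit_iff_dvd_one]
  have h : ∀ ω : ⋀[ℤ]^3 R.carrier, R.vol (e 0) (e 1) (e 2) ∣ R.orientation ω := by
    intro ω
    have hω : ω ∈ Submodule.span ℤ (Set.range (exteriorPower.ιMulti ℤ 3 (M := R.carrier))) := by
      rw [exteriorPower.ιMulti_span]
      trivial
    induction hω using Submodule.span_induction with
    | mem x hx =>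
      obtain ⟨v, rfl⟩ := hx
      have hv : v = ![v 0, v 1, v 2] := by
        funext i
        fin_cases i <;> rfl
      rw [hv]
      exact ⟨_, vol_eq_mul_det e (v 0) (v 1) (v 2)⟩
    | zero => simp
    | add x y _ _ hx hy => rw [map_add]; exact dvd_add hx hy
    | smul a x _ hx => rw [map_smul]; exact Dvd.dvd.mul_left hx a
  simpa using h (R.orientation.symm 1)

/-- Three elements of volume `1` form a basis. -/
theorem exists_basis_of_vol {x y z : R.carrier} (h : R.vol x y z = 1) :
    ∃ e : Basis (Fin 3) ℤ R.carrier, e 0 = x ∧ e 1 = y ∧ e 2 = z := by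
  have hd : IsUnit (R.basis.det ![x, y, z]) := by
    rw [vol_eq_mul_det R.basis] at h
    exact IsUnit.of_mul_eq_one_right _ h
  rw [← Basis.is_basis_iff_det] at hd
  refine ⟨Basis.mk hd.1 hd.2.ge, ?_, ?_, ?_⟩ <;> simp

section Coordinates

variable {e : Basis (Fin 3) ℤ R.carrier}

/-- Integer casts replace scalar multiplication here so that `ring` and `linear_combination` apply
to coordinates. -/
theorem repr_comb (h0 : e 0 = 1) (m p q : ℤ) :
    ⇑(e.repr ((m : R.carrier) + p * e 1 + q * e 2)) = ![m, p, q] := by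
  have : (m : R.carrier) + p * e 1 + q * e 2 = m • e 0 + p • e 1 + q • e 2 := by
    simp [h0, zsmul_eq_mul]
  rw [this]
  funext i
  fin_cases i <;> simp [-zsmul_eq_mul]

theorem eq_comb (h0 : e 0 = 1) (x : R.carrier) :
    x = (e.repr x 0 : R.carrier) + e.repr x 1 * e 1 + e.repr x 2 * e 2 := by
  conv_lhs => rw [← e.sum_repr x]
  simp [Fin.sum_univ_three, h0, zsmul_eq_mul]

theorem exists_comb (h0 : e 0 = 1) (x : R.carrier) :
    ∃ m p q : ℤ, x = (m : R.carrier) + p * e 1 + q * e 2 :=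
  ⟨_, _, _, eq_comb h0 x⟩

theorem comb_inj (h0 : e 0 = 1) {m p q m' p' q' : ℤ}
    (h : (m : R.carrier) + p * e 1 + q * e 2 = (m' : R.carrier) + p' * e 1 + q' * e 2) :
    m = m' ∧ p = p' ∧ q = q' := by
  have := congrArg (fun x => (e.repr x : Fin 3 → ℤ)) h
  simp only [repr_comb h0] at this
  exact ⟨congrFun this 0, congrFun this 1, congrFun this 2⟩

theorem vol_comb (h0 : e 0 = 1) (m p q k u w : ℤ) :
    R.vol 1 ((m : R.carrier) + p * e 1 + q * e 2) ((k : R.carrier) + u * e 1 + w * e 2) =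
      R.vol 1 (e 1) (e 2) * (p * w - q * u) := by
  rw [vol_eq_mul_det e, h0]
  congr 1
  have h1 : (1 : R.carrier) = ((1 : ℤ) : R.carrier) + (0 : ℤ) * e 1 + (0 : ℤ) * e 2 := by simp
  rw [Basis.det_apply, Matrix.det_fin_three]
  simp only [Basis.toMatrix_apply, Matrix.cons_val_zero, Matrix.cons_val_one, Matrix.cons_val]
  rw [h1, repr_comb h0, repr_comb h0, repr_comb h0]
  simp
  ring

theorem trace_comb (m p q : ℤ) :
    Algebra.trace ℤ R.carrier ((m : R.carrier) + p * e 1 + q * e 2) =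
      3 * m + p * Algebra.trace ℤ R.carrier (e 1) + q * Algebra.trace ℤ R.carrier (e 2) := by
  have : (m : R.carrier) + p * e 1 + q * e 2 =
      algebraMap ℤ R.carrier m + p • e 1 + q • e 2 := by
    simp [zsmul_eq_mul]
  rw [this, map_add, map_add, map_smul, map_smul, Algebra.trace_algebraMap, R.finrank_eq]
  simp

theorem trace_eq_of_mul {x : R.carrier} (h0 : e 0 = 1) {m p q k u w l a b : ℤ}
    (hx : x = (m : R.carrier) + p * e 1 + q * e 2)
    (h1 : x * e 1 = (k : R.carrier) + u * e 1 + w * e 2)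
    (h2 : x * e 2 = (l : R.carrier) + a * e 1 + b * e 2) :
    Algebra.trace ℤ R.carrier x = m + u + b := by
  rw [Algebra.trace_eq_matrix_trace e, Matrix.trace, Fin.sum_univ_three]
  simp only [Matrix.diag, Algebra.leftMulMatrix_eq_repr_mul]
  rw [h0, mul_one, h1, h2, hx, repr_comb h0, repr_comb h0, repr_comb h0]
  rfl

end Coordinates

/-- `e` is a basis `1, ω, θ` as in the correspondence of `R` with `f`. -/
def IsNormalBasis (e : Basis (Fin 3) ℤ R.carrier) (f : BinaryCubicForm) : Prop :=
  e 0 = 1 ∧ R.vol 1 (e 1) (e 2) = 1 ∧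
    e 1 * e 1 = (-(f.a * f.c)) • (1 : R.carrier) + f.b • e 1 - f.a • e 2 ∧
    e 1 * e 2 = (-(f.a * f.d)) • (1 : R.carrier) ∧
    e 2 * e 2 = (-(f.b * f.d)) • (1 : R.carrier) + f.d • e 1 - f.c • e 2

namespace IsNormalBasis

variable {e : Basis (Fin 3) ℤ R.carrier} {f : BinaryCubicForm}

theorem mul_one_one (h : IsNormalBasis e f) :
    e 1 * e 1 = -((f.a : R.carrier) * f.c) + f.b * e 1 - f.a * e 2 := by
  have := h.2.2.1
  simpa [zsmul_eq_mul] using this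

theorem mul_one_two (h : IsNormalBasis e f) : e 1 * e 2 = -((f.a : R.carrier) * f.d) := by
  have := h.2.2.2.1
  simpa [zsmul_eq_mul] using this

theorem mul_two_two (h : IsNormalBasis e f) :
    e 2 * e 2 = -((f.b : R.carrier) * f.d) + f.d * e 1 - f.c * e 2 := by
  have := h.2.2.2.2
  simpa [zsmul_eq_mul] using this

theorem trace_one (h : IsNormalBasis e f) : Algebra.trace ℤ R.carrier (e 1) = f.b := by
  rw [trace_eq_of_mul (x := e 1) h.1 (m := 0) (p := 1) (q := 0) (k := -(f.a * f.c)) (u := f.b)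
    (w := -f.a) (l := -(f.a * f.d)) (a := 0) (b := 0)]
  · ring
  · simp
  · rw [h.mul_one_one]; push_cast; ring
  · rw [h.mul_one_two]; push_cast; ring

theorem trace_two (h : IsNormalBasis e f) : Algebra.trace ℤ R.carrier (e 2) = -f.c := by
  rw [trace_eq_of_mul (x := e 2) h.1 (m := 0) (p := 0) (q := 1) (l := -(f.b * f.d)) (a := f.d)
    (b := -f.c) (k := -(f.a * f.d)) (u := 0) (w := 0)]
  · ring
  · simp
  · rw [mul_comm, h.mul_one_two]; push_cast; ring
  · rw [h.mul_two_two]; push_cast; ring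

theorem trace_comb (h : IsNormalBasis e f) (m p q : ℤ) :
    Algebra.trace ℤ R.carrier ((m : R.carrier) + p * e 1 + q * e 2) =
      3 * m + p * f.b - q * f.c := by
  rw [OrientedCubicRing.trace_comb, h.trace_one, h.trace_two]
  ring

theorem mul_comb (h : IsNormalBasis e f) (m p q k u w : ℤ) :
    ((m : R.carrier) + p * e 1 + q * e 2) * ((k : R.carrier) + u * e 1 + w * e 2) =
      ((m * k - f.a * f.c * p * u - f.a * f.d * (p * w + q * u) - f.b * f.d * q * w : ℤ) :
          R.carrier) +
        (m * u + p * k + f.b * p * u + f.d * q * w : ℤ) * e 1 +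
        (m * w + q * k - f.a * p * u - f.c * q * w : ℤ) * e 2 := by
  push_cast
  linear_combination (p * u : R.carrier) * h.mul_one_one +
    (p * w + q * u : R.carrier) * h.mul_one_two + (q * w : R.carrier) * h.mul_two_two

/-- The cubic form as index form. -/
theorem vol_sq (h : IsNormalBasis e f) (m p q : ℤ) :
    R.vol 1 ((m : R.carrier) + p * e 1 + q * e 2)
      (((m : R.carrier) + p * e 1 + q * e 2) ^ 2) = -f.eval p q := by
  rw [pow_two, h.mul_comb, vol_comb h.1, h.2.1, BinaryCubicForm.eval]
  ring

theorem disc_eq (h : IsNormalBasis e f) : R.disc = f.disc := by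
  rw [R.disc_eq e, Algebra.discr_def, Matrix.det_fin_three]
  simp only [Algebra.traceMatrix_apply, Algebra.traceForm_apply]
  have t0 := h.trace_comb 1 0 0
  have t11 := h.trace_comb (-(f.a * f.c)) f.b (-f.a)
  have t12 := h.trace_comb (-(f.a * f.d)) 0 0
  have t22 := h.trace_comb (-(f.b * f.d)) f.d (-f.c)
  have e11 : e 1 * e 1 = ((-(f.a * f.c) : ℤ) : R.carrier) + f.b * e 1 + (-f.a : ℤ) * e 2 := by
    rw [h.mul_one_one]; push_cast; ring
  have e12 : e 1 * e 2 = ((-(f.a * f.d) : ℤ) : R.carrier) + (0 : ℤ) * e 1 + (0 : ℤ) * e 2 := by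
    rw [h.mul_one_two]; push_cast; ring
  have e22 : e 2 * e 2 = ((-(f.b * f.d) : ℤ) : R.carrier) + f.d * e 1 + (-f.c : ℤ) * e 2 := by
    rw [h.mul_two_two]; push_cast; ring
  rw [← e11] at t11
  rw [← e12] at t12
  rw [← e22] at t22
  simp only [Int.cast_one, Int.cast_zero, zero_mul, add_zero] at t0
  simp only [h.1, one_mul, mul_one, mul_comm (e 2) (e 1), t0, t11, t12, t22, h.trace_one,
    h.trace_two, BinaryCubicForm.disc]
  ring

end IsNormalBasis

/-- A basis `1, x, y` becomes a normal basis after translation by integers. -/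
theorem exists_normalBasis {e : Basis (Fin 3) ℤ R.carrier} (h0 : e 0 = 1)
    (hv : R.vol 1 (e 1) (e 2) = 1) :
    ∃ (e' : Basis (Fin 3) ℤ R.carrier) (f : BinaryCubicForm) (k l : ℤ),
      IsNormalBasis e' f ∧ e' 1 = e 1 + k ∧ e' 2 = e 2 + l := by
  obtain ⟨n, r, s, hxy⟩ := exists_comb h0 (e 1 * e 2)
  -- If `xy = n + rx + sy`, then `(x - s)(y - r) = n + rs` is an integer.
  have hvol : R.vol 1 (e 1 + (-s : ℤ)) (e 2 + (-r : ℤ)) = 1 := by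
    have := vol_comb h0 (-s) 1 0 (-r) 0 1
    rw [hv] at this
    simpa [add_comm] using this
  obtain ⟨b, b0, b1, b2⟩ := exists_basis_of_vol hvol
  have h12 : b 1 * b 2 = ((n + r * s : ℤ) : R.carrier) := by
    rw [b1, b2]
    push_cast
    linear_combination hxy
  obtain ⟨A, β, α, h11⟩ := exists_comb b0 (b 1 * b 1)
  obtain ⟨B, δ, γ, h22⟩ := exists_comb b0 (b 2 * b 2)
  set N := n + r * s
  -- Associativity fixes the constants: `ω(ωθ) = (ω²)θ` gives `N = αδ` and `A = -αγ`; `θ(ωθ) =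
  -- ω(θ²)` gives `B = -βδ`.
  have E1 : ((0 : ℤ) : R.carrier) + (N : ℤ) * b 1 + (0 : ℤ) * b 2 =
      ((N * β + α * B : ℤ) : R.carrier) + (α * δ : ℤ) * b 1 + (A + α * γ : ℤ) * b 2 := by
    push_cast
    linear_combination b 2 * h11 + β * h12 - b 1 * h12 + α * h22
  have E2 : ((0 : ℤ) : R.carrier) + (0 : ℤ) * b 1 + (N : ℤ) * b 2 =
      ((N * γ + δ * A : ℤ) : R.carrier) + (B + δ * β : ℤ) * b 1 + (δ * α : ℤ) * b 2 := by
    push_cast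
    linear_combination b 1 * h22 + γ * h12 - b 2 * h12 + δ * h11
  obtain ⟨-, E1b, E1c⟩ := comb_inj b0 E1
  obtain ⟨-, E2b, -⟩ := comb_inj b0 E2
  refine ⟨b, ⟨-α, β, -γ, δ⟩, -s, -r, ⟨b0, ?_, ?_, ?_, ?_⟩, b1, b2⟩
  · rw [b1, b2, hvol]
  · have hA : A = -(-α * -γ) := by linarith
    rw [h11, hA]
    simp only [zsmul_eq_mul]
    push_cast
    ring
  · rw [h12, E1b]
    simp only [zsmul_eq_mul]
    push_cast
    ring
  · have hB : B = -(β * δ) := by linarith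
    rw [h22, hB]
    simp only [zsmul_eq_mul]
    push_cast
    ring

-- Smith normal form of the line `ℤ·1` gives `1 = kx` with `x` a basis vector. Then `k x² = x`, and
-- comparing coefficients of `x` shows that `k` is a unit.
variable (R) in
theorem exists_basis_one : ∃ e : Basis (Fin 3) ℤ R.carrier, e 0 = 1 := by
  have : Nontrivial R.carrier := Module.nontrivial_of_finrank_pos (R := ℤ)
    (by rw [R.finrank_eq]; norm_num)
  obtain ⟨n, bM, bN, f, a, snf⟩ :=
    (Submodule.span ℤ {(1 : R.carrier)}).smithNormalForm R.basis
  have hn : n ≤ 1 := by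
    have := finrank_span_le_card (R := ℤ) {(1 : R.carrier)}
    rw [Module.finrank_eq_card_basis bN] at this
    simpa using this
  let one : Submodule.span ℤ {(1 : R.carrier)} := ⟨1, Submodule.mem_span_singleton_self 1⟩
  obtain rfl : n = 1 := by
    rcases Nat.le_one_iff_eq_zero_or_eq_one.1 hn with rfl | h
    · have h1 := bN.sum_repr one
      have h2 := congrArg Subtype.val h1
      simp [one] at h2
    · exact h
  set x := bM (f 0) with hx
  obtain ⟨k, hk⟩ : ∃ k : ℤ, k • x = 1 := by
    have h2 := congrArg Subtype.val (bN.sum_repr one)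
    simp only [Fin.sum_univ_one, Submodule.coe_smul, snf, smul_smul, one] at h2
    exact ⟨_, h2⟩
  have hu : IsUnit k := by
    have hxx : k • (x * x) = x := by rw [← smul_mul_assoc, hk, one_mul]
    have h3 := congrArg (fun y => bM.repr y (f 0)) hxx
    simp only [map_smul, Finsupp.smul_apply, smul_eq_mul, hx, Basis.repr_self,
      Finsupp.single_eq_same] at h3
    exact IsUnit.of_mul_eq_one _ h3
  obtain ⟨ε, rfl⟩ := hu
  refine ⟨(bM.unitsSMul fun _ => ε).reindex (Equiv.swap (f 0) 0), ?_⟩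
  simpa [-zsmul_eq_mul, Basis.unitsSMul_apply, Units.smul_def, ← hx] using hk

variable (R) in
/-- Every oriented cubic ring corresponds to a binary cubic form. -/
theorem exists_correspondsTo : ∃ f, R.CorrespondsTo f := by
  obtain ⟨e, h0⟩ := exists_basis_one R
  have hu := isUnit_vol e
  rw [h0] at hu
  obtain ⟨e', h0', h1⟩ : ∃ e' : Basis (Fin 3) ℤ R.carrier, e' 0 = 1 ∧
      R.vol 1 (e' 1) (e' 2) = 1 := by
    rcases Int.isUnit_iff.1 hu with h | h
    · exact ⟨e, h0, h⟩
    -- For volume `-1`, interchange the last two basis vectors.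
    · have := vol_comb h0 0 0 1 0 1 0
      rw [h] at this
      simp at this
      obtain ⟨b, b0, b1, b2⟩ := exists_basis_of_vol this
      exact ⟨b, b0, by rw [b1, b2, this]⟩
  obtain ⟨b, f, -, -, hb, -⟩ := exists_normalBasis h0' h1
  exact ⟨f, b, hb⟩

theorem CorrespondsTo.disc_eq {f : BinaryCubicForm} (h : R.CorrespondsTo f) :
    R.disc = f.disc := by
  obtain ⟨e, he⟩ := h
  exact IsNormalBasis.disc_eq he

/-- A normal basis obtained from `1, p ω + q θ, u ω + w θ`. -/
theorem IsNormalBasis.exists_act {e : Basis (Fin 3) ℤ R.carrier} {f : BinaryCubicForm}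
    (h : IsNormalBasis e f) (γ : Matrix.SpecialLinearGroup (Fin 2) ℤ) :
    ∃ (e' : Basis (Fin 3) ℤ R.carrier) (k l : ℤ), IsNormalBasis e' (f.act γ) ∧
      e' 1 = (k : R.carrier) + γ.1 0 0 * e 1 + γ.1 0 1 * e 2 ∧
      e' 2 = (l : R.carrier) + γ.1 1 0 * e 1 + γ.1 1 1 * e 2 := by
  have hd := γ.2
  rw [Matrix.det_fin_two] at hd
  have hv := vol_comb h.1 0 (γ.1 0 0) (γ.1 0 1) 0 (γ.1 1 0) (γ.1 1 1)
  rw [h.2.1, hd, one_mul] at hv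
  obtain ⟨b, b0, b1, b2⟩ := exists_basis_of_vol hv
  obtain ⟨e', g, k, l, he, h1, h2⟩ := exists_normalBasis b0 (by rw [b1, b2, hv])
  have h1' : e' 1 = (k : R.carrier) + γ.1 0 0 * e 1 + γ.1 0 1 * e 2 := by
    rw [h1, b1]; push_cast; ring
  have h2' : e' 2 = (l : R.carrier) + γ.1 1 0 * e 1 + γ.1 1 1 * e 2 := by
    rw [h2, b2]; push_cast; ring
  refine ⟨e', k, l, ?_, h1', h2'⟩
  convert he
  -- The form of a normal basis is `-δ(1 ∧ z ∧ z²)` at `z = xω + yθ`, unchanged when integers are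
  -- added to `z`; so the new form is a substitution in the old one.
  apply BinaryCubicForm.eq_of_eval
  intro x y
  have hx := he.vol_sq 0 x y
  have : ((0 : ℤ) : R.carrier) + x * e' 1 + y * e' 2 = ((x * k + y * l : ℤ) : R.carrier) +
      (x * γ.1 0 0 + y * γ.1 1 0 : ℤ) * e 1 + (x * γ.1 0 1 + y * γ.1 1 1 : ℤ) * e 2 := by
    rw [h1', h2']; push_cast; ring
  rw [this, h.vol_sq] at hx
  rw [BinaryCubicForm.eval_act]
  linarith

theorem CorrespondsTo.act {f : BinaryCubicForm} (h : R.CorrespondsTo f)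
    (γ : Matrix.SpecialLinearGroup (Fin 2) ℤ) : R.CorrespondsTo (f.act γ) := by
  obtain ⟨e, he⟩ := h
  obtain ⟨e', -, -, he', -⟩ := IsNormalBasis.exists_act he γ
  exact ⟨e', he'⟩

/-- Two forms to which `R` corresponds are equivalent. -/
theorem CorrespondsTo.exists_act {f g : BinaryCubicForm} (hf : R.CorrespondsTo f)
    (hg : R.CorrespondsTo g) : ∃ γ : Matrix.SpecialLinearGroup (Fin 2) ℤ, g = f.act γ := by
  obtain ⟨e, he⟩ := hf
  obtain ⟨e', he'⟩ := hg
  change IsNormalBasis e f at he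
  change IsNormalBasis e' g at he'
  obtain ⟨k, p, q, h1⟩ := exists_comb he.1 (e' 1)
  obtain ⟨l, u, w, h2⟩ := exists_comb he.1 (e' 2)
  have hd := he'.2.1
  rw [h1, h2, vol_comb he.1, he.2.1, one_mul] at hd
  let γ : Matrix.SpecialLinearGroup (Fin 2) ℤ :=
    ⟨!![p, q; u, w], by rw [Matrix.det_fin_two_of]; linarith⟩
  refine ⟨γ, ?_⟩
  apply BinaryCubicForm.eq_of_eval
  intro x y
  have hx := he'.vol_sq 0 x y
  have : ((0 : ℤ) : R.carrier) + x * e' 1 + y * e' 2 = ((x * k + y * l : ℤ) : R.carrier) +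
      (x * p + y * u : ℤ) * e 1 + (x * q + y * w : ℤ) * e 2 := by
    rw [h1, h2]; push_cast; ring
  rw [this, he.vol_sq] at hx
  rw [BinaryCubicForm.eval_act]
  simp [γ]
  linarith

/-- Rings with normal bases for the same form are isomorphic along these bases. -/
theorem IsNormalBasis.exists_ringEquiv {S : OrientedCubicRing.{u}} {f : BinaryCubicForm}
    {e : Basis (Fin 3) ℤ R.carrier} {b : Basis (Fin 3) ℤ S.carrier} (he : IsNormalBasis e f)
    (hb : IsNormalBasis b f) : ∃ φ : R.carrier ≃+* S.carrier, ∀ i, φ (e i) = b i := by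
  let φ : R.carrier ≃ₗ[ℤ] S.carrier := e.equiv b (Equiv.refl _)
  have hφ : ∀ m p q : ℤ, φ ((m : R.carrier) + p * e 1 + q * e 2) =
      (m : S.carrier) + p * b 1 + q * b 2 := by
    intro m p q
    have : (m : R.carrier) + p * e 1 + q * e 2 = m • e 0 + p • e 1 + q • e 2 := by
      simp [he.1, zsmul_eq_mul]
    rw [this]
    simp only [φ, map_add, map_smul, Basis.equiv_apply, Equiv.refl_apply, hb.1]
    simp [zsmul_eq_mul]
  have hmul : ∀ x y, φ (x * y) = φ x * φ y := by
    intro x y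
    obtain ⟨m, p, q, rfl⟩ := exists_comb he.1 x
    obtain ⟨k, u, w, rfl⟩ := exists_comb he.1 y
    rw [he.mul_comb, hφ, hφ, hφ, hb.mul_comb]
  refine ⟨{ φ.toAddEquiv with map_mul' := hmul }, fun i => ?_⟩
  change φ (e i) = b i
  simp [φ]

/-- Rings that correspond to the same form are isomorphic. -/
theorem CorrespondsTo.iso {S : OrientedCubicRing.{u}} {f : BinaryCubicForm}
    (hR : R.CorrespondsTo f) (hS : S.CorrespondsTo f) : isoSetoid.r R S := by
  obtain ⟨e, he⟩ := hR
  obtain ⟨b, hb⟩ := hS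
  change IsNormalBasis e f at he
  change IsNormalBasis b f at hb
  obtain ⟨ψ, hψ⟩ := he.exists_ringEquiv hb
  refine ⟨ψ, (isOrientedIso_iff ψ e).2 ?_⟩
  rw [hψ, hψ, hψ, hb.1, hb.2.1, he.1, he.2.1]

theorem CorrespondsTo.of_iso {S : OrientedCubicRing.{u}} {f : BinaryCubicForm}
    (hR : R.CorrespondsTo f) (h : isoSetoid.r R S) : S.CorrespondsTo f := by
  obtain ⟨e, he⟩ := hR
  change IsNormalBasis e f at he
  obtain ⟨φ, hφ⟩ := h
  rw [isOrientedIso_iff φ e, he.1, he.2.1, map_one] at hφ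
  have hb : ∀ i, e.map φ.toAddEquiv.toIntLinearEquiv i = φ (e i) := fun i => by simp
  refine ⟨e.map φ.toAddEquiv.toIntLinearEquiv, ?_⟩
  rw [hb, hb, hb]
  refine ⟨by rw [he.1, map_one], hφ, ?_, ?_, ?_⟩
  · rw [← map_mul, he.2.2.1]; simp
  · rw [← map_mul, he.2.2.2.1]; simp
  · rw [← map_mul, he.2.2.2.2]; simp

end OrientedCubicRing
end CubicShape

namespace CubicShape

/-! ### The cubic ring of a binary cubic form -/

/-- The ring `ℤ ⊕ ℤ ω ⊕ ℤ θ` with the multiplication table of `f`. -/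
structure FormRing (f : BinaryCubicForm) : Type u where
  x : ℤ
  y : ℤ
  z : ℤ

namespace FormRing

variable {f : BinaryCubicForm}

instance : Zero (FormRing.{u} f) := ⟨⟨0, 0, 0⟩⟩
instance : One (FormRing.{u} f) := ⟨⟨1, 0, 0⟩⟩
instance : Add (FormRing.{u} f) := ⟨fun v w => ⟨v.x + w.x, v.y + w.y, v.z + w.z⟩⟩
instance : Neg (FormRing.{u} f) := ⟨fun v => ⟨-v.x, -v.y, -v.z⟩⟩
instance : Mul (FormRing.{u} f) := ⟨fun v w =>
  ⟨v.x * w.x - f.a * f.c * v.y * w.y - f.a * f.d * (v.y * w.z + v.z * w.y) -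
      f.b * f.d * v.z * w.z,
    v.x * w.y + v.y * w.x + f.b * v.y * w.y + f.d * v.z * w.z,
    v.x * w.z + v.z * w.x - f.a * v.y * w.y - f.c * v.z * w.z⟩⟩

theorem zero_def : (0 : FormRing.{u} f) = ⟨0, 0, 0⟩ := rfl
theorem one_def : (1 : FormRing.{u} f) = ⟨1, 0, 0⟩ := rfl
theorem add_def (v w : FormRing.{u} f) : v + w = ⟨v.x + w.x, v.y + w.y, v.z + w.z⟩ := rfl
theorem neg_def (v : FormRing.{u} f) : -v = ⟨-v.x, -v.y, -v.z⟩ := rfl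
theorem mul_def (v w : FormRing.{u} f) : v * w =
  ⟨v.x * w.x - f.a * f.c * v.y * w.y - f.a * f.d * (v.y * w.z + v.z * w.y) -
      f.b * f.d * v.z * w.z,
    v.x * w.y + v.y * w.x + f.b * v.y * w.y + f.d * v.z * w.z,
    v.x * w.z + v.z * w.x - f.a * v.y * w.y - f.c * v.z * w.z⟩ := rfl

instance : CommRing (FormRing.{u} f) :=
  CommRing.ofMinimalAxioms
    (by intro a b c; simp only [add_def, mk.injEq]; refine ⟨?_, ?_, ?_⟩ <;> ring)
    (by intro a; simp only [add_def, zero_def, zero_add])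
    (by intro a; simp only [add_def, neg_def, zero_def, neg_add_cancel])
    (by intro a b c; simp only [mul_def, mk.injEq]; refine ⟨?_, ?_, ?_⟩ <;> ring)
    (by intro a b; simp only [mul_def, mk.injEq]; refine ⟨?_, ?_, ?_⟩ <;> ring)
    (by intro a; simp [mul_def, one_def])
    (by intro a b c; simp only [mul_def, add_def, mk.injEq]; refine ⟨?_, ?_, ?_⟩ <;> ring)

/-- Coordinates on `FormRing f`. -/
def coordEquiv (f : BinaryCubicForm) : FormRing.{u} f ≃+ (Fin 3 → ℤ) where
  toFun v := ![v.x, v.y, v.z]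
  invFun v := ⟨v 0, v 1, v 2⟩
  left_inv v := rfl
  right_inv v := by
    funext i
    fin_cases i <;> rfl
  map_add' v w := by
    funext i
    fin_cases i <;> rfl

theorem coordEquiv_apply (v : FormRing.{u} f) : coordEquiv f v = ![v.x, v.y, v.z] := rfl

/-- The basis `1, ω, θ` of `FormRing f`. -/
noncomputable def basis (f : BinaryCubicForm) : Basis (Fin 3) ℤ (FormRing.{u} f) :=
  .ofEquivFun (coordEquiv f).toIntLinearEquiv

theorem basis_zero : basis.{u} f 0 = ⟨1, 0, 0⟩ := by
  rw [basis, Basis.coe_ofEquivFun]; rfl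

theorem basis_one : basis.{u} f 1 = ⟨0, 1, 0⟩ := by
  rw [basis, Basis.coe_ofEquivFun]; rfl

theorem basis_two : basis.{u} f 2 = ⟨0, 0, 1⟩ := by
  rw [basis, Basis.coe_ofEquivFun]; rfl

theorem basis_mul_one_one : basis.{u} f 1 * basis f 1 =
    (-(f.a * f.c)) • (1 : FormRing.{u} f) + f.b • basis f 1 - f.a • basis f 2 := by
  apply (coordEquiv f).injective
  rw [basis_one, basis_two]
  simp only [map_sub, map_add, map_zsmul, coordEquiv_apply, mul_def, one_def]
  funext i
  fin_cases i <;> simp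

theorem basis_mul_one_two : basis.{u} f 1 * basis f 2 =
    (-(f.a * f.d)) • (1 : FormRing.{u} f) := by
  apply (coordEquiv f).injective
  rw [basis_one, basis_two]
  simp only [map_zsmul, coordEquiv_apply, mul_def, one_def]
  funext i
  fin_cases i <;> simp

theorem basis_mul_two_two : basis.{u} f 2 * basis f 2 =
    (-(f.b * f.d)) • (1 : FormRing.{u} f) + f.d • basis f 1 - f.c • basis f 2 := by
  apply (coordEquiv f).injective
  rw [basis_one, basis_two]
  simp only [map_sub, map_add, map_zsmul, coordEquiv_apply, mul_def, one_def]
  funext i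
  fin_cases i <;> simp

end FormRing

/-- Only injective index families matter; these are permutations of the basis and contribute a sign.
-/
theorem alternatingMap_ext_basis {M N : Type*} [AddCommGroup M] [AddCommGroup N] {n : ℕ}
    (e : Basis (Fin n) ℤ M) {f g : M [⋀^Fin n]→ₗ[ℤ] N} (h : f e = g e) : f = g := by
  refine Basis.ext_alternating e fun v hv => ?_
  have hb : Function.Bijective v := Finite.injective_iff_bijective.1 hv
  have h1 := f.map_perm e (Equiv.ofBijective v hb)
  have h2 := g.map_perm e (Equiv.ofBijective v hb)
  rw [h, ← h2] at h1
  exact h1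

/-- The orientation of a free module of rank `n` in which a given basis has volume `1`. -/
noncomputable def orientationOfBasis {M : Type*} [AddCommGroup M] {n : ℕ}
    (e : Basis (Fin n) ℤ M) : (⋀[ℤ]^n M) ≃ₗ[ℤ] ℤ :=
  LinearEquiv.ofLinearMap (exteriorPower.alternatingMapLinearEquiv e.det)
    (LinearMap.toSpanSingleton ℤ _ (exteriorPower.ιMulti ℤ n e))
    (by
      ext
      simp [exteriorPower.alternatingMapLinearEquiv_apply_ιMulti, Basis.det_self])
    (by
      apply exteriorPower.linearMap_ext
      apply alternatingMap_ext_basis e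
      simp [exteriorPower.alternatingMapLinearEquiv_apply_ιMulti, Basis.det_self])

theorem orientationOfBasis_apply {M : Type*} [AddCommGroup M] {n : ℕ}
    (e : Basis (Fin n) ℤ M) : orientationOfBasis e (exteriorPower.ιMulti ℤ n e) = 1 := by
  simp [orientationOfBasis, exteriorPower.alternatingMapLinearEquiv_apply_ιMulti, Basis.det_self]

namespace OrientedCubicRing

/-- Every binary cubic form comes from an oriented cubic ring. -/
theorem exists_ring_correspondsTo (f : BinaryCubicForm) :
    ∃ R : OrientedCubicRing.{u}, R.CorrespondsTo f := by
  let e := FormRing.basis.{u} f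
  refine ⟨{ carrier := FormRing.{u} f
            free := Module.Free.of_basis e
            finrank_eq := by rw [Module.finrank_eq_card_basis e]; rfl
            orientation := orientationOfBasis e }, e, FormRing.basis_zero, ?_, ?_, ?_, ?_⟩
  · have h : (e : Fin 3 → FormRing.{u} f) = ![1, e 1, e 2] := by
      funext i
      fin_cases i
      · exact FormRing.basis_zero
      · rfl
      · rfl
    have h2 := orientationOfBasis_apply e
    rw [h] at h2
    exact h2
  · exact FormRing.basis_mul_one_one
  · exact FormRing.basis_mul_one_two
  · exact FormRing.basis_mul_two_two

/-! ### The shape of a cubic ring -/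

section Shape

variable {R : OrientedCubicRing.{u}} {e : Basis (Fin 3) ℤ R.carrier} {f : BinaryCubicForm}

/-- The element `x (3ω - b) + y (3θ + c)` of trace zero. -/
noncomputable def traceZeroElt (e : Basis (Fin 3) ℤ R.carrier) (f : BinaryCubicForm) (x y : ℤ) : R.carrier :=
  ((-(x * f.b) + y * f.c : ℤ) : R.carrier) + (3 * x : ℤ) * e 1 + (3 * y : ℤ) * e 2

/-- An element of `ℤ + 3R` is `m + 3xω + 3yθ` with `m` arbitrary, and its trace `3(m + xb - yc)`
vanishes for exactly one `m`. -/
theorem IsNormalBasis.mem_traceZero (h : IsNormalBasis e f) {z : R.carrier} :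
    z ∈ R.traceZero ↔ ∃ x y : ℤ, z = traceZeroElt e f x y := by
  rw [traceZero, Submodule.mem_inf, LinearMap.mem_ker, Submodule.mem_sup]
  constructor
  · rintro ⟨⟨_, h1, _, ⟨w, rfl⟩, rfl⟩, h2⟩
    obtain ⟨m, rfl⟩ := Submodule.mem_span_singleton.1 h1
    obtain ⟨k, x, y, rfl⟩ := exists_comb h.1 w
    have hz : m • (1 : R.carrier) + ((3 : ℤ) • (LinearMap.id : R.carrier →ₗ[ℤ] R.carrier))
        ((k : R.carrier) + x * e 1 + y * e 2) =
        ((m + 3 * k : ℤ) : R.carrier) + (3 * x : ℤ) * e 1 + (3 * y : ℤ) * e 2 := by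
      rw [LinearMap.smul_apply, LinearMap.id_apply]
      simp only [zsmul_eq_mul]
      push_cast
      ring
    rw [hz] at h2 ⊢
    rw [h.trace_comb] at h2
    refine ⟨x, y, ?_⟩
    rw [traceZeroElt, show m + 3 * k = -(x * f.b) + y * f.c by linarith]
  · rintro ⟨x, y, rfl⟩
    refine ⟨⟨(-(x * f.b) + y * f.c : ℤ) • (1 : R.carrier),
      Submodule.mem_span_singleton.2 ⟨_, rfl⟩, _, ⟨x * e 1 + y * e 2, rfl⟩, ?_⟩, ?_⟩
    · rw [LinearMap.smul_apply, LinearMap.id_apply, traceZeroElt]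
      simp only [zsmul_eq_mul]
      push_cast
      ring
    · rw [traceZeroElt, h.trace_comb]
      ring

theorem IsNormalBasis.trace_sq (h : IsNormalBasis e f) (v : Fin 2 → ℤ) :
    Algebra.trace ℤ R.carrier (traceZeroElt e f (v 0) (v 1) ^ 2) = 6 * f.hessian.eval v := by
  rw [pow_two, traceZeroElt, h.mul_comb, h.trace_comb]
  simp only [BinaryCubicForm.hessian, BinaryQuadraticForm.eval]
  ring

theorem traceZeroElt_comb (x y p q u w : ℤ) :
    x • traceZeroElt e f p q + y • traceZeroElt e f u w =
      traceZeroElt e f (x * p + y * u) (x * q + y * w) := by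
  simp only [traceZeroElt, zsmul_eq_mul]
  push_cast
  ring

theorem IsNormalBasis.traceZeroElt_inj (h : IsNormalBasis e f) {x y x' y' : ℤ}
    (hxy : traceZeroElt e f x y = traceZeroElt e f x' y') : x = x' ∧ y = y' := by
  have := comb_inj h.1 hxy
  omega

theorem IsNormalBasis.vol_traceZeroElt (h : IsNormalBasis e f) (p q u w : ℤ) :
    R.vol 1 (traceZeroElt e f p q) (traceZeroElt e f u w) = 9 * (p * w - q * u) := by
  rw [traceZeroElt, traceZeroElt, vol_comb h.1, h.2.1]
  ring

/-- The oriented basis giving shape `Q` differs from `3ω - b, 3θ + c` by some `g ∈ SL₂(ℤ)`.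
Substituting `g` makes six times the Hessian equal to `nQ`, and primitivity gives `6 ∣ n`. -/
theorem HasShape.exists_form {Q : BinaryQuadraticForm} (hR : R.HasShape Q) :
    ∃ (g : BinaryCubicForm) (n : ℤ), 0 < n ∧ g.hessian = Q.scale n ∧ R.CorrespondsTo g := by
  obtain ⟨-, hP, ε, n, hn, hvol, htr⟩ := hR
  obtain ⟨f, e, he⟩ := R.exists_correspondsTo
  change IsNormalBasis e f at he
  obtain ⟨p, q, h0⟩ := he.mem_traceZero.1 (ε 0).2
  obtain ⟨u, w, h1⟩ := he.mem_traceZero.1 (ε 1).2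
  have hcomb : ∀ x y : ℤ, ∃ α β : ℤ, α * p + β * u = x ∧ α * q + β * w = y := by
    intro x y
    have h2 := ε.sum_repr ⟨traceZeroElt e f x y, he.mem_traceZero.2 ⟨x, y, rfl⟩⟩
    rw [Fin.sum_univ_two] at h2
    have h3 := congrArg Subtype.val h2
    simp only [Submodule.coe_add, Submodule.coe_smul, h0, h1, traceZeroElt_comb] at h3
    exact ⟨_, _, he.traceZeroElt_inj h3⟩
  obtain ⟨α, β, a1, a2⟩ := hcomb 1 0
  obtain ⟨γ, δ, a3, a4⟩ := hcomb 0 1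
  rw [h0, h1, he.vol_traceZeroElt] at hvol
  -- The change of basis is invertible, so its determinant is `±1`; positive volume excludes `-1`.
  have hdet : p * w - q * u = 1 := by
    have : (p * w - q * u) * (α * δ - β * γ) = 1 := by
      linear_combination (γ * q + δ * w) * a1 + a4 - (γ * p + δ * u) * a2
    rcases Int.isUnit_iff.1 (IsUnit.of_mul_eq_one _ this) with h | h <;> omega
  let g : Matrix.SpecialLinearGroup (Fin 2) ℤ :=
    ⟨!![p, q; u, w], by rw [Matrix.det_fin_two_of]; linarith⟩
  have hH : Q.scale n = (f.act g).hessian.scale 6 := by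
    apply BinaryQuadraticForm.eq_of_eval
    intro v
    rw [BinaryQuadraticForm.eval_scale, BinaryQuadraticForm.eval_scale, ← htr, h0, h1,
      traceZeroElt_comb, f.hessian_act]
    convert he.trace_sq (Matrix.vecMul v g.1) using 4 <;>
      simp [g, Matrix.vecMul, dotProduct, Fin.sum_univ_two]
  simp only [BinaryQuadraticForm.scale, BinaryQuadraticForm.mk.injEq] at hH
  obtain ⟨m, rfl⟩ : (6 : ℤ) ∣ n := hP.dvd ⟨_, hH.1⟩ ⟨_, hH.2.1⟩ ⟨_, hH.2.2⟩
  refine ⟨f.act g, m, by omega, ?_, CorrespondsTo.act ⟨e, he⟩ g⟩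
  have h6 : (6 : ℤ) ≠ 0 := by norm_num
  obtain ⟨k1, k2, k3⟩ := hH
  generalize (f.act g).hessian = H at *
  obtain ⟨r, s, t⟩ := H
  simp only [BinaryQuadraticForm.scale, BinaryQuadraticForm.mk.injEq]
  refine ⟨mul_left_cancel₀ h6 ?_, mul_left_cancel₀ h6 ?_, mul_left_cancel₀ h6 ?_⟩ <;>
    simp only [] at * <;> linarith

/-- The basis `3ω - b, 3θ + c` has volume `9 > 0` and trace form `6nQ`. -/
theorem hasShape_of_hessian {Q : BinaryQuadraticForm} (hP : Q.IsPrimitive) (hQ : Q.disc ≠ 0)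
    {n : ℤ} (hn : 0 < n) (hH : f.hessian = Q.scale n) (hf : R.CorrespondsTo f) :
    R.HasShape Q := by
  obtain ⟨e, he⟩ := hf
  change IsNormalBasis e f at he
  refine ⟨?_, hP, ?_⟩
  · rw [he.disc_eq]
    intro h
    have h3 := f.three_mul_disc
    rw [h, hH, BinaryQuadraticForm.disc_scale] at h3
    have : n ^ 2 * Q.disc ≠ 0 := mul_ne_zero (pow_ne_zero 2 hn.ne') hQ
    omega
  · let τ : ℤ → ℤ → R.traceZero := fun x y =>
      ⟨traceZeroElt e f x y, he.mem_traceZero.2 ⟨x, y, rfl⟩⟩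
    have hτ : ∀ x y : ℤ, x • τ 1 0 + y • τ 0 1 = τ x y := by
      intro x y
      apply Subtype.ext
      change x • traceZeroElt e f 1 0 + y • traceZeroElt e f 0 1 = traceZeroElt e f x y
      rw [traceZeroElt_comb]
      simp
    have hli : LinearIndependent ℤ ![τ 1 0, τ 0 1] := by
      rw [LinearIndependent.pair_iff]
      intro x y hxy
      rw [hτ] at hxy
      apply he.traceZeroElt_inj
      have := congrArg Subtype.val hxy
      refine this.trans ?_
      simp [traceZeroElt]
    have hsp : ⊤ ≤ Submodule.span ℤ (Set.range ![τ 1 0, τ 0 1]) := by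
      rintro ⟨z, hz⟩ -
      obtain ⟨x, y, rfl⟩ := he.mem_traceZero.1 hz
      rw [Matrix.range_cons_cons_empty]
      exact Submodule.mem_span_pair.2 ⟨x, y, hτ x y⟩
    refine ⟨Basis.mk hli hsp, 6 * n, by omega, ?_, ?_⟩
    · rw [Basis.mk_apply, Basis.mk_apply]
      change 0 < R.vol 1 (traceZeroElt e f 1 0) (traceZeroElt e f 0 1)
      rw [he.vol_traceZeroElt]
      norm_num
    · intro v
      rw [Basis.mk_apply, Basis.mk_apply]
      change Algebra.trace ℤ R.carrier
        ((v 0 • traceZeroElt e f 1 0 + v 1 • traceZeroElt e f 0 1) ^ 2) = _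
      have := he.trace_sq v
      rw [hH, BinaryQuadraticForm.eval_scale] at this
      rw [traceZeroElt_comb, mul_assoc, ← this]
      simp

end Shape

end OrientedCubicRing
end CubicShape

namespace CubicShape

/-! ### Cubic rings with an automorphism of order three -/

/-- A form of discriminant `-3` represents `1` or `-1`. -/
theorem exists_sq_eq_one_of_disc_neg_three (A B C : ℤ) (h : B ^ 2 - 4 * A * C = -3) :
    ∃ x y : ℤ, (A * x ^ 2 + B * x * y + C * y ^ 2) ^ 2 = 1 := by
  induction hn : A.natAbs using Nat.strong_induction_on generalizing A B C with
  | _ n ih =>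
    have hA : A ≠ 0 := by
      rintro rfl
      nlinarith [sq_nonneg B]
    by_cases h1 : A.natAbs = 1
    · refine ⟨1, 0, ?_⟩
      have := Int.natAbs_pow_two A
      rw [h1] at this
      simp [← this]
    have hA2 : 2 ≤ |A| := by rw [Int.abs_eq_natAbs]; omega
    -- Gauss reduction: a translation makes `|B'| ≤ |A|`, so `4|A||C'| = B'² + 3 ≤ A² + 3 < 4A²` as
    -- `|A| ≥ 2`. The descent continues with the outer coefficients interchanged.
    obtain ⟨k, hk⟩ : ∃ k : ℤ, |B + 2 * k * A| ≤ |A| := by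
      refine ⟨-((B + |A|) / (2 * A)), ?_⟩
      have h2 := Int.emod_add_mul_ediv (B + |A|) (2 * A)
      have h3 := Int.emod_nonneg (B + |A|) (b := 2 * A) (by omega)
      have h4 := Int.emod_lt_abs (B + |A|) (b := 2 * A) (by omega)
      rw [abs_mul, abs_two] at h4
      have h5 : B + 2 * -((B + |A|) / (2 * A)) * A = (B + |A|) % (2 * A) - |A| := by
        linear_combination -h2
      rw [h5, abs_le]
      constructor <;> linarith
    set B' := B + 2 * k * A with hB'
    set C' := A * k ^ 2 + B * k + C with hC'
    have hd : (-B') ^ 2 - 4 * C' * A = -3 := by rw [hB', hC']; linear_combination h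
    have hlt : C'.natAbs < n := by
      have h6 : B' ^ 2 ≤ A ^ 2 := sq_le_sq.2 hk
      have h7 : 4 * (|A| * |C'|) = B' ^ 2 + 3 := by
        rw [← abs_mul, abs_of_pos] <;> nlinarith
      have h8 : |A| ^ 2 = A ^ 2 := sq_abs A
      have h9 : |C'| < |A| := by
        by_contra hc
        push Not at hc
        nlinarith
      rw [Int.abs_eq_natAbs, Int.abs_eq_natAbs] at h9
      omega
    obtain ⟨x, y, hxy⟩ := ih _ hlt C' (-B') A hd rfl
    refine ⟨k * x - y, x, ?_⟩
    rw [← hxy, hC', hB']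
    ring

/-- A nontrivial `2 × 2` integer matrix with cube `1` has trace `-1` and determinant `1`. -/
theorem trace_det_of_cube_eq_one {M : Matrix (Fin 2) (Fin 2) ℤ} (h3 : M * M * M = 1)
    (h1 : M ≠ 1) : M 0 0 + M 1 1 = -1 ∧ M 0 0 * M 1 1 - M 0 1 * M 1 0 = 1 := by
  have hd : M.det = 1 := by
    have h := congrArg Matrix.det h3
    simp only [Matrix.det_mul, Matrix.det_one] at h
    nlinarith [sq_nonneg (M.det + 1), sq_nonneg (M.det), sq_nonneg (M.det - 1)]
  rw [Matrix.det_fin_two] at hd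
  refine ⟨?_, hd⟩
  have e00 := congrFun (congrFun h3 0) 0
  have e01 := congrFun (congrFun h3 0) 1
  have e10 := congrFun (congrFun h3 1) 0
  have e11 := congrFun (congrFun h3 1) 1
  simp [Matrix.mul_apply, Fin.sum_univ_two] at e00 e01 e10 e11
  have hM : ¬ (M 0 0 = 1 ∧ M 0 1 = 0 ∧ M 1 0 = 0 ∧ M 1 1 = 1) := by
    rintro ⟨a1, a2, a3, a4⟩
    apply h1
    ext i j
    fin_cases i <;> fin_cases j <;> simp [a1, a2, a3, a4]
  generalize M 0 0 = p at *
  generalize M 0 1 = q at *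
  generalize M 1 0 = r at *
  generalize M 1 1 = w at *
  set τ := p + w with hτ
  -- Cayley–Hamilton with determinant one: `M³ = (τ² - 1)M - τ`. Unless `τ² = 1`, where `τ = -1`
  -- follows, `M` is scalar, hence `±1`, and both are excluded.
  have f00 : (τ ^ 2 - 1) * p - τ = 1 := by
    rw [hτ]; linear_combination e00 + (2 * p + w) * hd
  have f01 : (τ ^ 2 - 1) * q = 0 := by
    rw [hτ]; linear_combination e01 + q * hd
  have f10 : (τ ^ 2 - 1) * r = 0 := by
    rw [hτ]; linear_combination e10 + r * hd
  have f11 : (τ ^ 2 - 1) * w - τ = 1 := by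
    rw [hτ]; linear_combination e11 + (2 * w + p) * hd
  by_cases ht : τ ^ 2 - 1 = 0
  · rw [ht] at f00
    linarith
  · exfalso
    have hq : q = 0 := (mul_eq_zero.1 f01).resolve_left ht
    have hr : r = 0 := (mul_eq_zero.1 f10).resolve_left ht
    have hw : p = w := mul_left_cancel₀ ht (by linarith)
    subst hq hr hw
    have hp : (p - 1) * (p + 1) = 0 := by linarith
    rcases mul_eq_zero.1 hp with h | h
    · exact hM ⟨by linarith, rfl, rfl, by linarith⟩
    · obtain rfl : p = -1 := by linarith
      norm_num [hτ] at f00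

namespace BinaryQuadraticForm

theorem eisenstein_isPrimitive : eisenstein.IsPrimitive := fun _ h _ _ => isUnit_of_dvd_one h

/-- A form with a nontrivial automorphism of order three is a multiple of `x² + x y + y²`. -/
theorem exists_eval_eq_eisenstein (H : BinaryQuadraticForm) {M : Matrix (Fin 2) (Fin 2) ℤ}
    (ht : M 0 0 + M 1 1 = -1) (hd : M 0 0 * M 1 1 - M 0 1 * M 1 0 = 1)
    (hH : ∀ v, H.eval (Matrix.vecMul v M) = H.eval v) :
    ∃ (γ : Matrix.SpecialLinearGroup (Fin 2) ℤ) (n : ℤ),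
      ∀ v, H.eval (Matrix.vecMul v γ.1) = n * eisenstein.eval v := by
  -- Put `v = (a,b)` and `v' = vM`. Since `v'M = -(v + v')`, the form takes equal values at `v`,
  -- `v'` and `v + v'`, which forces `H(xv - yv') = H(v)(x² + xy + y²)`.
  have key : ∀ a b : ℤ, ∀ x y : ℤ,
      H.eval ![x * a - y * (a * M 0 0 + b * M 1 0), x * b - y * (a * M 0 1 + b * M 1 1)] =
        H.eval ![a, b] * (x ^ 2 + x * y + y ^ 2) := by
    intro a b x y
    have k1 := hH ![a, b]
    have k2 := hH (Matrix.vecMul ![a, b] M)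
    simp only [eval, Matrix.vecMul, dotProduct, Fin.sum_univ_two, Matrix.cons_val_zero,
      Matrix.cons_val_one] at k1 k2 ⊢
    have c0 : (a * M 0 0 + b * M 1 0) * M 0 0 + (a * M 0 1 + b * M 1 1) * M 1 0 =
        -(a + (a * M 0 0 + b * M 1 0)) := by
      linear_combination (a * M 0 0 + b * M 1 0) * ht - a * hd
    have c1 : (a * M 0 0 + b * M 1 0) * M 0 1 + (a * M 0 1 + b * M 1 1) * M 1 1 =
        -(b + (a * M 0 1 + b * M 1 1)) := by
      linear_combination (a * M 0 1 + b * M 1 1) * ht - b * hd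
    rw [c0, c1] at k2
    generalize a * M 0 0 + b * M 1 0 = a' at *
    generalize a * M 0 1 + b * M 1 1 = b' at *
    linear_combination y ^ 2 * k1 - x * y * k2
  -- As a form in `v`, `det(v, vM)` has discriminant `τ² - 4 = -3`; so some `v, vM` form a basis of
  -- `ℤ²`. The sign decides the order of `v` and `-vM`.
  obtain ⟨a, b, hab⟩ := exists_sq_eq_one_of_disc_neg_three (M 0 1) (M 1 1 - M 0 0) (-M 1 0)
    (by linear_combination (M 0 0 + M 1 1 - 1) * ht - 4 * hd)
  rw [pow_two, mul_self_eq_one_iff] at hab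
  rcases hab with h | h
  · let γ : Matrix.SpecialLinearGroup (Fin 2) ℤ :=
      ⟨!![-(a * M 0 0 + b * M 1 0), -(a * M 0 1 + b * M 1 1); a, b], by
        rw [Matrix.det_fin_two_of]; linear_combination h⟩
    refine ⟨γ, H.eval ![a, b], fun v => ?_⟩
    have hv : Matrix.vecMul v γ.1 = ![v 1 * a - v 0 * (a * M 0 0 + b * M 1 0),
        v 1 * b - v 0 * (a * M 0 1 + b * M 1 1)] := by
      funext i
      fin_cases i <;> simp [γ, Matrix.vecMul, dotProduct, Fin.sum_univ_two] <;> ring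
    rw [hv, key]
    simp only [eisenstein, eval]
    ring
  · let γ : Matrix.SpecialLinearGroup (Fin 2) ℤ :=
      ⟨!![a, b; -(a * M 0 0 + b * M 1 0), -(a * M 0 1 + b * M 1 1)], by
        rw [Matrix.det_fin_two_of]; linear_combination -h⟩
    refine ⟨γ, H.eval ![a, b], fun v => ?_⟩
    have hv : Matrix.vecMul v γ.1 = ![v 0 * a - v 1 * (a * M 0 0 + b * M 1 0),
        v 0 * b - v 1 * (a * M 0 1 + b * M 1 1)] := by
      funext i
      fin_cases i <;> simp [γ, Matrix.vecMul, dotProduct, Fin.sum_univ_two] <;> ring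
    rw [hv, key]
    simp only [eisenstein, eval]
    ring

end BinaryQuadraticForm

namespace OrientedCubicRing

variable {R : OrientedCubicRing.{u}}

-- An automorphism preserves traces, hence the trace-zero lattice and the Hessian. Its matrix `M` on
-- `R/ℤ` has order three, so the Hessian is equivalent to a multiple of `x² + xy + y²`.
open BinaryQuadraticForm in
theorem IsC3.exists_form (hR : R.IsC3) :
    ∃ (g : BinaryCubicForm) (n : ℤ),
      0 < n ∧ g.hessian = eisenstein.scale n ∧ R.CorrespondsTo g := by
  obtain ⟨hdisc, σ, hσ⟩ := hR
  obtain ⟨f, e, he⟩ := R.exists_correspondsTo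
  change IsNormalBasis e f at he
  obtain ⟨k, p, q, h1⟩ := exists_comb he.1 (σ (e 1))
  obtain ⟨l, r, w, h2⟩ := exists_comb he.1 (σ (e 2))
  have hcomb : ∀ m x y : ℤ, σ ((m : R.carrier) + x * e 1 + y * e 2) =
      ((m + x * k + y * l : ℤ) : R.carrier) + (x * p + y * r : ℤ) * e 1 +
        (x * q + y * w : ℤ) * e 2 := by
    intro m x y
    rw [map_add, map_add, map_mul, map_mul, map_intCast, map_intCast, map_intCast, h1, h2]
    push_cast
    ring
  have hcube : ∀ z, σ (σ (σ z)) = z := by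
    intro z
    have h := pow_orderOf_eq_one σ
    rw [hσ] at h
    exact congrArg (fun τ : R.carrier ≃+* R.carrier => τ z) h
  have hne : σ ≠ 1 := by
    rintro rfl
    simp at hσ
  have E1 : σ (σ (σ (((0 : ℤ) : R.carrier) + (1 : ℤ) * e 1 + (0 : ℤ) * e 2))) = _ := hcube _
  have E2 : σ (σ (σ (((0 : ℤ) : R.carrier) + (0 : ℤ) * e 1 + (1 : ℤ) * e 2))) = _ := hcube _
  rw [hcomb, hcomb, hcomb] at E1 E2
  obtain ⟨a1, a2, a3⟩ := comb_inj he.1 E1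
  obtain ⟨b1, b2, b3⟩ := comb_inj he.1 E2
  set M : Matrix (Fin 2) (Fin 2) ℤ := !![p, q; r, w] with hM
  have hM3 : M * M * M = 1 := by
    ext i j
    fin_cases i <;> fin_cases j <;> simp [hM, Matrix.mul_apply, Fin.sum_univ_two] <;> linarith
  have hM1 : M ≠ 1 := by
    intro h
    have g1 : p = 1 := by simpa [hM] using congrFun (congrFun h 0) 0
    have g2 : q = 0 := by simpa [hM] using congrFun (congrFun h 0) 1
    have g3 : r = 0 := by simpa [hM] using congrFun (congrFun h 1) 0
    have g4 : w = 1 := by simpa [hM] using congrFun (congrFun h 1) 1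
    subst g1 g2 g3 g4
    apply hne
    ext z
    obtain ⟨m, x, y, rfl⟩ := exists_comb he.1 z
    -- If `M = 1`, then `σ³ = 1` gives `3k = 3l = 0`.
    rw [hcomb, show k = 0 by linarith, show l = 0 by linarith]
    simp
  obtain ⟨ht, hd⟩ := trace_det_of_cube_eq_one hM3 hM1
  have htr : ∀ z, Algebra.trace ℤ R.carrier (σ z) = Algebra.trace ℤ R.carrier z := fun z =>
    Algebra.trace_eq_of_algEquiv (AlgEquiv.ofRingEquiv (f := σ) (by simp)) z
  have hinv : ∀ v, f.hessian.eval (Matrix.vecMul v M) = f.hessian.eval v := by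
    intro v
    have hσv : σ (traceZeroElt e f (v 0) (v 1)) =
        traceZeroElt e f (Matrix.vecMul v M 0) (Matrix.vecMul v M 1) := by
      have t1 := htr (traceZeroElt e f (v 0) (v 1))
      rw [traceZeroElt, hcomb, he.trace_comb, he.trace_comb] at t1
      rw [traceZeroElt, traceZeroElt, hcomb]
      simp only [hM, Matrix.vecMul, dotProduct, Fin.sum_univ_two, Matrix.of_apply,
        Matrix.cons_val_zero, Matrix.cons_val_one, Matrix.cons_val', Matrix.cons_val_fin_one]
      congr 2
      · congr 1
        linarith
      · congr 2
        ring
      · congr 1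
        ring
    have t2 := htr (traceZeroElt e f (v 0) (v 1) ^ 2)
    rw [map_pow, hσv, he.trace_sq, he.trace_sq] at t2
    linarith
  obtain ⟨γ, n, hγ⟩ := exists_eval_eq_eisenstein f.hessian ht hd hinv
  have hH : (f.act γ).hessian = eisenstein.scale n := by
    apply BinaryQuadraticForm.eq_of_eval
    intro v
    rw [f.hessian_act, hγ, eval_scale]
  have hcorr : R.CorrespondsTo (f.act γ) := CorrespondsTo.act ⟨e, he⟩ γ
  refine ⟨f.act γ, n, ?_, hH, hcorr⟩
  have hn : n ≠ 0 := by
    rintro rfl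
    have h3 := (f.act γ).three_mul_disc
    rw [hH, disc_scale, ← hcorr.disc_eq] at h3
    apply hdisc
    linarith
  have h4 := (outer_of_hessian hn hH).1
  have h5 := hH
  simp only [BinaryCubicForm.hessian, scale, eisenstein, BinaryQuadraticForm.mk.injEq] at h4 h5
  generalize f.act γ = g at *
  -- The multiple is positive because it is nonzero and a value of a positive definite form.
  have h6 : n = g.b ^ 2 - g.b * g.c + g.c ^ 2 := by
    linear_combination -h5.1 + g.c * h4
  have h7 : 0 ≤ n := by nlinarith [sq_nonneg (2 * g.b - g.c), sq_nonneg g.c]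
  omega

-- The outer relations give `d = -a` and `b = c + 3a`; such a form is fixed by the order-three
-- matrix `γ`. So `γ` carries a normal basis to a normal basis of the same form, which defines `σ`;
-- the translations `k, l` cancel in `σ³`.
open BinaryQuadraticForm in
theorem isC3_of_hessian {f : BinaryCubicForm} {n : ℤ} (hn : 0 < n)
    (hH : f.hessian = eisenstein.scale n) (hf : R.CorrespondsTo f) : R.IsC3 := by
  refine ⟨(hasShape_of_hessian eisenstein_isPrimitive (disc_ne_zero eisenstein_disc) hn hH hf).1,
    ?_⟩
  obtain ⟨e, he⟩ := hf
  change IsNormalBasis e f at he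
  let γ : Matrix.SpecialLinearGroup (Fin 2) ℤ := ⟨!![-1, 1; -1, 0], by simp⟩
  have hfix : f.act γ = f := by
    obtain ⟨h1, h2⟩ := outer_of_hessian hn.ne' hH
    apply BinaryCubicForm.eq_of_eval
    intro x y
    rw [BinaryCubicForm.eval_act]
    simp only [eisenstein] at h1 h2
    have hd : f.d = -f.a := by linarith
    have hb : f.b = f.c + 3 * f.a := by linarith
    simp [γ, BinaryCubicForm.eval, hd, hb]
    ring
  obtain ⟨b, k, l, hb, b1, b2⟩ := he.exists_act γ
  rw [hfix] at hb
  obtain ⟨σ, hσ⟩ := he.exists_ringEquiv hb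
  have s1 : σ (e 1) = k - e 1 + e 2 := by rw [hσ, b1]; simp [γ]; ring
  have s2 : σ (e 2) = l - e 1 := by rw [hσ, b2]; simp [γ]; ring
  refine ⟨σ, orderOf_eq_prime ?_ ?_⟩
  · ext z
    obtain ⟨m, x, y, rfl⟩ := exists_comb he.1 z
    change σ (σ (σ _)) = (m : R.carrier) + x * e 1 + y * e 2
    simp only [map_add, map_sub, map_mul, map_intCast, s1, s2]
    ring
  · intro h
    rw [h] at s1
    have h3 : ((0 : ℤ) : R.carrier) + (1 : ℤ) * e 1 + (0 : ℤ) * e 2 =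
        (k : R.carrier) + (-1 : ℤ) * e 1 + (1 : ℤ) * e 2 := by
      simpa [sub_eq_add_neg] using s1
    have := (comb_inj he.1 h3).2.1
    norm_num at this

end OrientedCubicRing

/-! ### The bijection -/

namespace BinaryQuadraticForm

open OrientedCubicRing

variable {Q : BinaryQuadraticForm}

theorem cubicOrbit_eq_iff (hQ : ¬ IsSquare Q.disc) {v w : Q.LPlus} :
    Q.cubicOrbit hQ v = Q.cubicOrbit hQ w ↔
      ∃ γ : Q.SO, Matrix.mulVec (γ ^ 3).1.1 w.1 = v.1 := by
  let := cubicAction Q hQ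
  change Quotient.mk (MulAction.orbitRel Q.SO Q.LPlus) v = Quotient.mk _ w ↔ _
  rw [Quotient.eq, MulAction.orbitRel_apply, MulAction.mem_orbit_iff]
  exact exists_congr fun γ => ⟨fun h => congrArg Subtype.val h, fun h => Subtype.ext h⟩

theorem comesFrom_iff {v : Fin 2 → ℤ} {R : OrientedCubicRing.{u}} : ComesFrom Q v R ↔
    ∃ (f : BinaryCubicForm) (n : ℤ),
      f.b = v 0 ∧ f.c = v 1 ∧ 0 < n ∧ f.hessian = Q.scale n ∧ R.CorrespondsTo f := by
  constructor
  · rintro ⟨f, h0, h1, ⟨n, hn, hH⟩, hf⟩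
    exact ⟨f, n, h0, h1, hn, hH, hf⟩
  · rintro ⟨f, n, h0, h1, hn, hH, hf⟩
    exact ⟨f, h0, h1, ⟨n, hn, hH⟩, hf⟩

/-- Two forms of `R` are related by some `γ ∈ SL₂(ℤ)`. Since `3 Disc(R) = -n² Disc(Q)`, their
Hessians are the same multiple of `Q`, so `γ` preserves `Q` and acts on `(b,c)` as `γ³`. -/
theorem comesFrom_same_ring_iff (hQ : ¬ IsSquare Q.disc) {v w : Q.LPlus}
    {R : OrientedCubicRing.{u}} (hv : ComesFrom Q v.1 R) :
    ComesFrom Q w.1 R ↔ Q.cubicOrbit hQ w = Q.cubicOrbit hQ v := by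
  obtain ⟨f, n, f0, f1, hn, hf, hRf⟩ := comesFrom_iff.1 hv
  rw [cubicOrbit_eq_iff]
  constructor
  · intro hw
    obtain ⟨g, m, g0, g1, hm, hg, hRg⟩ := comesFrom_iff.1 hw
    have hnm : m = n := by
      have d1 := f.three_mul_disc
      have d2 := g.three_mul_disc
      rw [hf, disc_scale, ← hRf.disc_eq] at d1
      rw [hg, disc_scale, ← hRg.disc_eq] at d2
      have : m ^ 2 = n ^ 2 := mul_right_cancel₀ (disc_ne_zero hQ) (by linarith)
      exact (sq_eq_sq₀ hm.le hn.le).1 this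
    subst hnm
    obtain ⟨γ, rfl⟩ := hRf.exists_act hRg
    refine ⟨⟨γ, mem_SO_of_hessian_act hm.ne' hf hg⟩, ?_⟩
    obtain ⟨k0, k1⟩ := middle_act hQ hm.ne' hf ⟨γ, mem_SO_of_hessian_act hm.ne' hf hg⟩ f0 f1
    funext i
    fin_cases i
    · exact k0.symm.trans g0
    · exact k1.symm.trans g1
  · rintro ⟨γ, hγ⟩
    obtain ⟨k0, k1⟩ := middle_act hQ hn.ne' hf γ f0 f1
    rw [hγ] at k0 k1
    exact comesFrom_iff.2 ⟨f.act γ.1, n, k0, k1, hn, hessian_act_of_mem_SO hf γ, hRf.act γ.1⟩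

/-- The outer relations determine `a, d` from `b, c` independently of `n`, so both rings correspond
to one form. -/
theorem comesFrom_same_vector_iff {v : Fin 2 → ℤ} (hQ : ¬ IsSquare Q.disc)
    {R S : OrientedCubicRing.{u}} (hR : ComesFrom Q v R) :
    ComesFrom Q v S ↔ isoSetoid.r R S := by
  obtain ⟨f, n, f0, f1, hn, hf, hRf⟩ := comesFrom_iff.1 hR
  constructor
  · intro hS
    obtain ⟨g, m, g0, g1, hm, hg, hSg⟩ := comesFrom_iff.1 hS
    obtain ⟨o1, o2⟩ := outer_of_hessian hn.ne' hf
    obtain ⟨o3, o4⟩ := outer_of_hessian hm.ne' hg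
    rw [f0, f1] at o1 o2
    rw [g0, g1] at o3 o4
    have hr := r_ne_zero hQ
    have ht := t_ne_zero hQ
    have ha : g.a = f.a :=
      mul_left_cancel₀ (mul_ne_zero (by norm_num : (3 : ℤ) ≠ 0) ht) (by linarith)
    have hd : g.d = f.d :=
      mul_left_cancel₀ (mul_ne_zero (by norm_num : (3 : ℤ) ≠ 0) hr) (by linarith)
    obtain rfl : g = f := by
      obtain ⟨a, b, c, d⟩ := f
      obtain ⟨a', b', c', d'⟩ := g
      simp only [BinaryCubicForm.mk.injEq] at *
      exact ⟨ha, g0.trans f0.symm, g1.trans f1.symm, hd⟩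
    exact hRf.iso hSg
  · intro h
    exact comesFrom_iff.2 ⟨f, n, f0, f1, hn, hf, hRf.of_iso h⟩

theorem exists_ring_comesFrom (hP : Q.IsPrimitive) (hQ : ¬ IsSquare Q.disc) (v : Q.LPlus) :
    ∃ R : OrientedCubicRing.{u}, ComesFrom Q v.1 R := by
  obtain ⟨f, n, h0, h1, hn, hf⟩ := exists_form_of_mem_LPlus hP hQ v.2
  obtain ⟨R, hR⟩ := exists_ring_correspondsTo.{u} f
  exact ⟨R, comesFrom_iff.2 ⟨f, n, h0, h1, hn, hf, hR⟩⟩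

/-- The orbits of the cubic action classify the rings that correspond to a form whose Hessian is
a positive multiple of `Q`. -/
theorem exists_equiv_classes (hP : Q.IsPrimitive) (hQ : ¬ IsSquare Q.disc)
    {P : OrientedCubicRing.{u} → Prop}
    (hPR : ∀ R, P R ↔ ∃ (f : BinaryCubicForm) (n : ℤ),
      0 < n ∧ f.hessian = Q.scale n ∧ R.CorrespondsTo f) :
    ∃ Φ : Q.CubicOrbits hQ ≃ Classes.{u} P, ∀ (v : Q.LPlus) (R : {R // P R}),
      Φ (Q.cubicOrbit hQ v) = cls R ↔ ComesFrom Q v.1 R.1 := by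
  have hcls : ∀ R S : {R // P R}, cls R = cls S ↔ isoSetoid.r R.1 S.1 := fun R S =>
    Quotient.eq
  have hex : ∀ v : Q.LPlus, ∃ R : {R // P R}, ComesFrom Q v.1 R.1 := by
    intro v
    obtain ⟨R, hR⟩ := exists_ring_comesFrom.{u} hP hQ v
    obtain ⟨f, n, -, -, hn, hf, hRf⟩ := comesFrom_iff.1 hR
    exact ⟨⟨R, (hPR R).2 ⟨f, n, hn, hf, hRf⟩⟩, hR⟩
  choose F hF using hex
  have hFR : ∀ (v : Q.LPlus) (R : {R // P R}), cls (F v) = cls R ↔ ComesFrom Q v.1 R.1 :=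
    fun v R => (hcls _ _).trans (comesFrom_same_vector_iff hQ (hF v)).symm
  -- One direction makes the map well defined on orbits, the other makes it injective.
  have horb : ∀ v w : Q.LPlus,
      cls (F v) = cls (F w) ↔ Q.cubicOrbit hQ v = Q.cubicOrbit hQ w := fun v w =>
    (hFR v (F w)).trans (comesFrom_same_ring_iff hQ (hF w))
  let φ : Q.CubicOrbits hQ → Classes.{u} P :=
    letI := cubicAction Q hQ
    Quotient.lift (fun v => cls (F v)) fun v w h => (horb v w).2 (Quotient.sound h)
  have hφ : ∀ v, φ (Q.cubicOrbit hQ v) = cls (F v) := fun v => rfl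
  have hsurj : ∀ o : Q.CubicOrbits hQ, ∃ v, Q.cubicOrbit hQ v = o := Quotient.exists_rep
  refine ⟨Equiv.ofBijective φ ⟨?_, ?_⟩, hFR⟩
  · intro o o' h
    obtain ⟨v, rfl⟩ := hsurj o
    obtain ⟨w, rfl⟩ := hsurj o'
    exact (horb v w).1 h
  · intro C
    obtain ⟨R, rfl⟩ := Quotient.exists_rep C
    obtain ⟨f, n, hn, hf, hRf⟩ := (hPR R.1).1 R.2
    refine ⟨Q.cubicOrbit hQ ⟨_, mem_LPlus_of_hessian hQ hn hf⟩, ?_⟩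
    exact (hFR _ R).2 (comesFrom_iff.2 ⟨f, n, rfl, rfl, hn, hf, hRf⟩)

theorem exists_disc_of_comesFrom {v : Fin 2 → ℤ} {R : OrientedCubicRing.{u}}
    (h : ComesFrom Q v R) :
    ∃ n : ℤ, Q.adjoint.eval v = n * (Q.r * Q.t) ∧ 3 * R.disc = -(n ^ 2 * Q.disc) := by
  obtain ⟨f, n, h0, h1, hn, hf, hRf⟩ := comesFrom_iff.1 h
  refine ⟨n, ?_, ?_⟩
  · rw [← adjoint_eval_of_hessian hn.ne' hf]
    simp [eval, h0, h1]
  · rw [hRf.disc_eq, f.three_mul_disc, hf, disc_scale]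

theorem disc_of_comesFrom (hQ : ¬ IsSquare Q.disc) {v : Fin 2 → ℤ} {R : OrientedCubicRing.{u}}
    (h : ComesFrom Q v R) :
    (R.disc : ℚ) = -((Q.adjoint.eval v : ℚ) ^ 2 * (Q.disc : ℚ)) /
      (3 * (Q.r : ℚ) ^ 2 * (Q.t : ℚ) ^ 2) := by
  obtain ⟨n, h1, h2⟩ := exists_disc_of_comesFrom h
  have hr : (Q.r : ℚ) ≠ 0 := by exact_mod_cast r_ne_zero hQ
  have ht : (Q.t : ℚ) ≠ 0 := by exact_mod_cast t_ne_zero hQ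
  have h2' : 3 * (R.disc : ℚ) = -((n : ℚ) ^ 2 * Q.disc) := by exact_mod_cast h2
  rw [h1]
  push_cast
  field_simp
  linarith

theorem disc_of_comesFrom_eisenstein {v : Fin 2 → ℤ} {R : OrientedCubicRing.{u}}
    (h : ComesFrom eisenstein v R) :
    R.disc = (v 0 ^ 2 - v 0 * v 1 + v 1 ^ 2) ^ 2 := by
  obtain ⟨n, h1, h2⟩ := exists_disc_of_comesFrom h
  simp only [eval, adjoint, eisenstein, disc] at h1 h2
  have h3 : v 0 ^ 2 - v 0 * v 1 + v 1 ^ 2 = n := by linarith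
  rw [h3]
  linarith

theorem eisenstein_LPlus :
    eisenstein.LPlus = {v : Fin 2 → ℤ | v 0 ≡ v 1 [ZMOD 3] ∧ v ≠ 0} := by
  ext v
  have hpos : 0 < (eisenstein.adjoint.eval v : ℚ) / ((eisenstein.r : ℚ) * (eisenstein.t : ℚ)) ↔
      v ≠ 0 := by
    simp only [eval, adjoint, eisenstein, Int.cast_one, mul_one, div_one, Int.cast_pos]
    constructor
    · rintro h rfl
      simp at h
    · intro h
      have : v 0 ≠ 0 ∨ v 1 ≠ 0 := by
        by_contra! hc
        apply h
        funext i
        fin_cases i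
        · exact hc.1
        · exact hc.2
      rcases this with h | h
      -- Completing the square: `4(b² - bc + c²) = (2c - b)² + 3b²`.
      · nlinarith [sq_nonneg (2 * v 1 - v 0), sq_pos_of_ne_zero h]
      · nlinarith [sq_nonneg (2 * v 0 - v 1), sq_pos_of_ne_zero h]
  have hL : v ∈ eisenstein.L ↔ v 0 ≡ v 1 [ZMOD 3] := by
    simp only [L, Set.mem_ofPred_eq, eisenstein, one_mul, mul_one]
    exact ⟨fun h => h.1, fun h => ⟨h, h.symm⟩⟩
  exact and_congr hL hpos

end BinaryQuadraticForm
end CubicShape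

open CubicShape
theorem theorem4p1 :
    (∀ (Q : BinaryQuadraticForm) (_ : Q.IsPrimitive) (hQ : ¬ IsSquare Q.disc),
      ∃ Φ : Q.CubicOrbits hQ ≃
          OrientedCubicRing.Classes.{u} (fun R => R.HasShape Q),
        ∀ (v : Q.LPlus) (R : {R : OrientedCubicRing.{u} // R.HasShape Q}),
          (Φ (Q.cubicOrbit hQ v) = OrientedCubicRing.cls R ↔
            ComesFrom Q v.1 R.1) ∧
          (Φ (Q.cubicOrbit hQ v) = OrientedCubicRing.cls R →
            (R.1.disc : ℚ) = -((Q.adjoint.eval v.1 : ℚ) ^ 2 * (Q.disc : ℚ)) /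
              (3 * (Q.r : ℚ) ^ 2 * (Q.t : ℚ) ^ 2))) ∧
    (BinaryQuadraticForm.eisenstein.LPlus =
      {v : Fin 2 → ℤ | v 0 ≡ v 1 [ZMOD 3] ∧ v ≠ 0}) ∧
    (∃ Φ : BinaryQuadraticForm.eisenstein.CubicOrbits
            BinaryQuadraticForm.eisenstein_disc ≃
          OrientedCubicRing.Classes.{u} (fun R => R.IsC3),
        ∀ (v : BinaryQuadraticForm.eisenstein.LPlus)
          (R : {R : OrientedCubicRing.{u} // R.IsC3}),
          (Φ (BinaryQuadraticForm.eisenstein.cubicOrbit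
              BinaryQuadraticForm.eisenstein_disc v) =
                OrientedCubicRing.cls R ↔
            ComesFrom BinaryQuadraticForm.eisenstein v.1 R.1) ∧
          (Φ (BinaryQuadraticForm.eisenstein.cubicOrbit
              BinaryQuadraticForm.eisenstein_disc v) =
                OrientedCubicRing.cls R →
            R.1.disc = (v.1 0 ^ 2 - v.1 0 * v.1 1 + v.1 1 ^ 2) ^ 2)) := by
  refine ⟨fun Q hP hQ => ?_, BinaryQuadraticForm.eisenstein_LPlus, ?_⟩
  · obtain ⟨Φ, hΦ⟩ := BinaryQuadraticForm.exists_equiv_classes.{u} hP hQ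
      (P := fun R => R.HasShape Q) fun R =>
        ⟨fun h => h.exists_form, fun ⟨_, _, hn, hf, hR⟩ =>
          OrientedCubicRing.hasShape_of_hessian hP (BinaryQuadraticForm.disc_ne_zero hQ) hn hf hR⟩
    exact ⟨Φ, fun v R => ⟨hΦ v R, fun h =>
      BinaryQuadraticForm.disc_of_comesFrom hQ ((hΦ v R).1 h)⟩⟩
  · obtain ⟨Φ, hΦ⟩ := BinaryQuadraticForm.exists_equiv_classes.{u}
      BinaryQuadraticForm.eisenstein_isPrimitive BinaryQuadraticForm.eisenstein_disc
      (P := fun R => R.IsC3) fun R =>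
        ⟨fun h => h.exists_form, fun ⟨_, _, hn, hf, hR⟩ =>
          OrientedCubicRing.isC3_of_hessian hn hf hR⟩
    exact ⟨Φ, fun v R => ⟨hΦ v R, fun h =>
      BinaryQuadraticForm.disc_of_comesFrom_eisenstein ((hΦ v R).1 h)⟩⟩
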